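/- **Setting.** Let $n,m,r\ge 1$, $C\in\mathbb R^{n\times m}$, $\delta\in(0,\tfrac1r)$. For $Q\in\mathbb R^{n\times r}$, $R\in\mathbb R^{m\times r}$, $T\in\mathbb R^{r\times r}$ write $g_Q=Q^{\mathrm T}\mathbf 1_n$, $g_R=R^{\mathrm T}\mathbf 1_m$ (the inner marginals), $X=\mathrm{diag}(1/g_Q)\,T\,\mathrm{diag}(1/g_R)$, and $$\mathcal L(Q,R,T)=\langle Q\,\mathrm{diag}(1/g_Q)\,T\,\mathrm{diag}(1/g_R)\,R^{\mathrm T},C\rangle_F .$$ Let $\nabla_Q=CRX^{\mathrm T}-\mathbf 1_n\,\mathrm{diag}^{-1}\big((CRX^{\mathrm T})^{\mathrm T}Q\,\mathrm{diag}(1/g_Q)\big)^{\mathrm T}$, $\nabla_R=C^{\mathrm T}QX-\mathbf 1_m\,\mathrm{diag}^{-1}\big(\mathrm{diag}(1/g_R)R^{\mathrm T}C^{\mathrm T}QX\big)^{\mathrm T}$, $\nabla_T=\mathrm{diag}(1/g_Q)Q^{\mathrm T}CR\,\mathrm{diag}(1/g_R)$, where $\mathrm{diag}^{-1}$ extracts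 the diagonal. *FRLC algorithm* (balanced case) with outer marginals $a\in\Delta_n$, $b\in\Delta_m$ (probability vectors), penalty weight $\tau>0$ and step sizes $\gamma_k,\gamma^T_k>0$. It starts at entrywise nonnegative $(Q_0,R_0,T_0)$ with $Q_0\mathbf 1=a$, $R_0\mathbf 1=b$, $g_{Q_0}=g_{R_0}=T_0\mathbf 1=T_0^{\mathrm T}\mathbf 1=\frac1r\mathbf 1_r$. For a kernel $K$, vectors $p,q$ and an exponent $s$, "$l$ inner iterations" means: start with $u=\mathbf 1$, $v=\mathbf 1$, repeat $l$ times $u\leftarrow p/(Kv)$, $v\leftarrow (q/(K^{\mathrm T}u))^{s}$ (entrywise, $0/0:=0$), and return $\mathrm{diag}(u)K\,\mathrm{diag}(v)$. With $s_k=\tau/(\tau+\gamma_k^{-1})$ and $\nabla_Q,\nabla_R$ evaluated at $(Q_k,R_k,T_k)$, $Q_{k+1}$ is the output of $l^Q_k$ inner iterations with $K=Q_k\odot e^{-\gamma_k\nabla_Q}$, $p=a$, $q=g_{Q_k}$, $s=s_k$ (semi-relaxed projection); $R_{k+1}$ is the output of $l^R_k$ inner iterations with $K=R_k\odot e^{-\gamma_k\nabla_R}$,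 $p=b$, $q=g_{R_k}$, $s=s_k$; and then, with $\nabla_T$ evaluated at $(Q_{k+1},R_{k+1})$, $T_{k+1}$ is the output of $l^T_k$ inner iterations with $K=T_k\odot e^{-\gamma^T_k\nabla_T}$, $p=g_{Q_{k+1}}$, $q=g_{R_{k+1}}$, $s=1$ (Sinkhorn). Let $\mathcal D_\delta^{n}$ be the set of entrywise nonnegative $M\in\mathbb R^{n\times r}$ with total mass $\sum_{ij}M_{ij}\le 2$ and every entry of $M^{\mathrm T}\mathbf 1_n$ greater than $\delta$ (this contains every nonnegative $M$ with $M\mathbf 1_r\in\Delta_n$ and $M^{\mathrm T}\mathbf 1_n>\delta$ entrywise), let $\mathcal D_\delta^{m}$ be defined likewise, and let $\mathcal T$ be the set of entrywise nonnegative $r\times r$ matrices with total mass at most $2$. **Proposition.** 1. Let $N\in\mathbb N$ and let $g^{(0)},g^{(1)},\dots\in\mathbb R^r$ with $g^{(0)}=\frac1r\mathbf 1_r$ and $\|g^{(k+1)}-g^{(k)}\|_2<\frac1N\left(\frac1r-\delta\right)$ for all $k<N$. Then every entry of $g^{(k)}$ is greater than $\delta$, for all $k\le N$. 2. For every $n,m,r,C,\delta$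 as above and every number $N$ of outer iterations there is $\tau_0>0$ such that for every $\tau\ge\tau_0$ there is a function $l_0:\mathbb R\to\mathbb N$ (a number of inner iterations, depending on the step size) with the following property. For all $a$, $b$, all initial points and all step sizes as above, if $l^Q_k\ge l_0(\gamma_k)$, $l^R_k\ge l_0(\gamma_k)$ and $l^T_k\ge1$ for all $k<N$, then $$\|g_{Q_{k+1}}-g_{Q_k}\|_2<\tfrac1N\left(\tfrac1r-\delta\right),\qquad \|g_{R_{k+1}}-g_{R_k}\|_2<\tfrac1N\left(\tfrac1r-\delta\right)\qquad(k<N),$$ and for all $k\le N$ every entry of $g_{Q_k}$ and of $g_{R_k}$ is greater than $\delta$; moreover $Q_k\in\mathcal D^n_\delta$, $R_k\in\mathcal D^m_\delta$, $T_k\in\mathcal T$. 3. There are real polynomials $p_Q,p_R,p_T$ in five variables such that for all $n,m,r,C,\delta$ as above the numbers $\beta_\bullet=p_\bullet(\|C\|_F,n,m,r,1/\delta)$ are positive and $\mathcal L$ is block-wise smooth with these constants. That is, for all $R\in\mathcal D^m_\delta$, $T\in\mathcal T$ the function $Q\mapsto\mathcal L(Q,R,T)$ is differentiable at every point of $\mathcal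 D^n_\delta$ and $$\|\nabla_Q\mathcal L(Q',R,T)-\nabla_Q\mathcal L(Q,R,T)\|_F\le\beta_Q\|Q'-Q\|_F\qquad(Q,Q'\in\mathcal D^n_\delta);$$ for all $Q\in\mathcal D^n_\delta$, $T\in\mathcal T$ the same holds for $R\mapsto\mathcal L(Q,R,T)$ on $\mathcal D^m_\delta$ with $\beta_R$; and for all $Q\in\mathcal D^n_\delta$, $R\in\mathcal D^m_\delta$ the same holds for $T\mapsto\mathcal L(Q,R,T)$ on $\mathcal T$ with $\beta_T$. -/

import Mathlib

open scoped Matrix Matrix.Norms.Frobenius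

noncomputable section

namespace FRLC

/-- The inner marginal `Mᵀ 1` of a sub-coupling `M` (its vector of column sums). -/
def innerMarginal {n r : ℕ} (M : Matrix (Fin n) (Fin r) ℝ) : Fin r → ℝ :=
  Mᵀ *ᵥ 1

/-- The inner matrix `X = diag(1/g_Q) T diag(1/g_R)`. -/
def innerMatrix {n m r : ℕ} (Q : Matrix (Fin n) (Fin r) ℝ) (R : Matrix (Fin m) (Fin r) ℝ)
    (T : Matrix (Fin r) (Fin r) ℝ) : Matrix (Fin r) (Fin r) ℝ :=
  Matrix.diagonal (fun j => 1 / innerMarginal Q j) * T *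
    Matrix.diagonal (fun j => 1 / innerMarginal R j)

/-- The objective `⟨Q diag(1/g_Q) T diag(1/g_R) Rᵀ, C⟩_F`. -/
def objective {n m r : ℕ} (C : Matrix (Fin n) (Fin m) ℝ) (Q : Matrix (Fin n) (Fin r) ℝ)
    (R : Matrix (Fin m) (Fin r) ℝ) (T : Matrix (Fin r) (Fin r) ℝ) : ℝ :=
  ∑ i, ∑ j, (Q * innerMatrix Q R T * Rᵀ) i j * C i j

/-! ### The algorithm -/

/-- A triple `(Q, R, T)` of sub-couplings. -/
structure Triple (n m r : ℕ) where
  Q : Matrix (Fin n) (Fin r) ℝ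
  R : Matrix (Fin m) (Fin r) ℝ
  T : Matrix (Fin r) (Fin r) ℝ

/-- Nonnegative matrices with row sums `p` and column sums `q`. -/
def couplings {n m : ℕ} (p : Fin n → ℝ) (q : Fin m → ℝ) : Set (Matrix (Fin n) (Fin m) ℝ) :=
  {P | (∀ i j, 0 ≤ P i j) ∧ P *ᵥ 1 = p ∧ Pᵀ *ᵥ 1 = q}

/-- `∇_Q = C R Xᵀ - 1 diag⁻¹((C R Xᵀ)ᵀ Q diag(1/g_Q))ᵀ`. -/
def gradQ {n m r : ℕ} (C : Matrix (Fin n) (Fin m) ℝ) (x : Triple n m r) :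
    Matrix (Fin n) (Fin r) ℝ :=
  C * x.R * (innerMatrix x.Q x.R x.T)ᵀ -
    Matrix.vecMulVec 1 (Matrix.diag ((C * x.R * (innerMatrix x.Q x.R x.T)ᵀ)ᵀ * x.Q *
      Matrix.diagonal (fun j => 1 / innerMarginal x.Q j)))

/-- `∇_R = Cᵀ Q X - 1 diag⁻¹(diag(1/g_R) Rᵀ Cᵀ Q X)ᵀ`. -/
def gradR {n m r : ℕ} (C : Matrix (Fin n) (Fin m) ℝ) (x : Triple n m r) :
    Matrix (Fin m) (Fin r) ℝ :=
  Cᵀ * x.Q * innerMatrix x.Q x.R x.T -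
    Matrix.vecMulVec 1 (Matrix.diag (Matrix.diagonal (fun j => 1 / innerMarginal x.R j) *
      x.Rᵀ * Cᵀ * x.Q * innerMatrix x.Q x.R x.T))

/-- `∇_T = diag(1/g_Q) Qᵀ C R diag(1/g_R)`. -/
def gradT {n m r : ℕ} (C : Matrix (Fin n) (Fin m) ℝ) (Q : Matrix (Fin n) (Fin r) ℝ)
    (R : Matrix (Fin m) (Fin r) ℝ) : Matrix (Fin r) (Fin r) ℝ :=
  Matrix.diagonal (fun j => 1 / innerMarginal Q j) * Qᵀ * C * R *
    Matrix.diagonal (fun j => 1 / innerMarginal R j)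

/-- The multiplicative kernel `M ⊙ exp(-γ G)`. -/
def mdKernel {n m : ℕ} (M G : Matrix (Fin n) (Fin m) ℝ) (γ : ℝ) : Matrix (Fin n) (Fin m) ℝ :=
  Matrix.of fun i j => M i j * Real.exp (-γ * G i j)

/-- Scaling vectors `(u, v)` after a number of rounds of
`u ← a / K v`, `v ← (b / Kᵀ u) ^ s`, started at `u = 1`, `v = 1`. -/
def scalings {n m : ℕ} (K : Matrix (Fin n) (Fin m) ℝ) (s : ℝ) (a : Fin n → ℝ) (b : Fin m → ℝ) :
    ℕ → (Fin n → ℝ) × (Fin m → ℝ)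
  | 0 => (1, 1)
  | l + 1 =>
    let v := (scalings K s a b l).2
    let u : Fin n → ℝ := fun i => a i / (K *ᵥ v) i
    (u, fun j => (b j / (Kᵀ *ᵥ u) j) ^ s)

/-- The matrix `diag(u) K diag(v)` after `l` rounds. -/
def scaled {n m : ℕ} (K : Matrix (Fin n) (Fin m) ℝ) (s : ℝ) (a : Fin n → ℝ) (b : Fin m → ℝ)
    (l : ℕ) : Matrix (Fin n) (Fin m) ℝ :=
  Matrix.diagonal (scalings K s a b l).1 * K * Matrix.diagonal (scalings K s a b l).2

/-- Semi-relaxed projection (right marginal relaxed, penalty weight `τ`, step size `γ`),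
stopped after `l` inner iterations. -/
def srProjection {n m : ℕ} (K : Matrix (Fin n) (Fin m) ℝ) (γ τ : ℝ) (a : Fin n → ℝ)
    (b : Fin m → ℝ) (l : ℕ) : Matrix (Fin n) (Fin m) ℝ :=
  scaled K (τ / (τ + γ⁻¹)) a b l

/-- Sinkhorn's algorithm stopped after `l` inner iterations. -/
def sinkhorn {n m : ℕ} (K : Matrix (Fin n) (Fin m) ℝ) (a : Fin n → ℝ) (b : Fin m → ℝ) (l : ℕ) :
    Matrix (Fin n) (Fin m) ℝ :=
  scaled K 1 a b l

/-- One outer iteration: semi-relaxed projections for `Q` and `R`, then a Sinkhorn step for `T`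
between the new inner marginals. Here `γ` and `γT` are the two step sizes and `lQ`, `lR`, `lT`
the numbers of inner iterations. -/
def step {n m r : ℕ} (C : Matrix (Fin n) (Fin m) ℝ) (a : Fin n → ℝ) (b : Fin m → ℝ)
    (τ γ γT : ℝ) (lQ lR lT : ℕ) (x : Triple n m r) : Triple n m r :=
  let Q := srProjection (mdKernel x.Q (gradQ C x) γ) γ τ a (innerMarginal x.Q) lQ
  let R := srProjection (mdKernel x.R (gradR C x) γ) γ τ b (innerMarginal x.R) lR
  { Q := Q
    R := R
    T := sinkhorn (mdKernel x.T (gradT C Q R) γT) (innerMarginal Q) (innerMarginal R) lT }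

/-- The outer iterates, for given sequences of step sizes and numbers of inner iterations. -/
def iterate {n m r : ℕ} (C : Matrix (Fin n) (Fin m) ℝ) (a : Fin n → ℝ) (b : Fin m → ℝ)
    (τ : ℝ) (γ γT : ℕ → ℝ) (lQ lR lT : ℕ → ℕ) (x₀ : Triple n m r) : ℕ → Triple n m r
  | 0 => x₀
  | k + 1 =>
    step C a b τ (γ k) (γT k) (lQ k) (lR k) (lT k) (iterate C a b τ γ γT lQ lR lT x₀ k)

/-! ### Smoothness -/

/-- Nonnegative `n × r` matrices of total mass at most `2` whose inner marginal is entrywise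
larger than `δ`. Every nonnegative matrix whose row sums form a probability vector has total
mass `1`; the slack makes room for projections stopped after finitely many inner iterations. -/
def factorDomain (n r : ℕ) (δ : ℝ) : Set (Matrix (Fin n) (Fin r) ℝ) :=
  {M | (∀ i j, 0 ≤ M i j) ∧ ∑ i, ∑ j, M i j ≤ 2 ∧ ∀ j, δ < innerMarginal M j}

/-- Nonnegative `r × r` matrices of total mass at most `2`. -/
def latentDomain (r : ℕ) : Set (Matrix (Fin r) (Fin r) ℝ) :=
  {T | (∀ i j, 0 ≤ T i j) ∧ ∑ i, ∑ j, T i j ≤ 2}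

/-- The gradient (matrix of partial derivatives) of a function of a matrix. -/
def matGradient {n m : ℕ} (f : Matrix (Fin n) (Fin m) ℝ → ℝ) (M : Matrix (Fin n) (Fin m) ℝ) :
    Matrix (Fin n) (Fin m) ℝ :=
  Matrix.of fun i j => fderiv ℝ f M (Matrix.single i j 1)

/-- `f` is `β`-smooth on `S`: it is differentiable at all points of `S` (as a function on the
whole matrix space) and its gradient is `β`-Lipschitz on `S` in the Frobenius norm. -/
def SmoothOn {n m : ℕ} (f : Matrix (Fin n) (Fin m) ℝ → ℝ) (S : Set (Matrix (Fin n) (Fin m) ℝ))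
    (β : ℝ) : Prop :=
  (∀ M ∈ S, DifferentiableAt ℝ f M) ∧
    ∀ M ∈ S, ∀ M' ∈ S, ‖matGradient f M' - matGradient f M‖ ≤ β * ‖M' - M‖

end FRLC

end

/-! Vectors are compared on a logarithmic scale (`LogClose`). There, applying a nonnegative matrix
and dividing a fixed vector by the argument are nonexpansive, and raising to the power `s`
multiplies distances by `s`. For `s < 1` the semi-relaxed iteration thus contracts geometrically,
with constants uniform in the matrix and the marginals. After enough rounds the row sums match `a`
up to a factor `exp η`, whatever the previous error within that tolerance, so row errors do not
accumulate over outer iterations.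

The change of the column marginal is controlled by an energy inequality. Let `P = diag(u) K diag(v)`
be the output and `diag(w) Q` the rescaling of `Q` with row sums exactly `a`. Since `log` is
monotone, `∑ (P - diag(w) Q)(log P - log (diag(w) Q)) ≥ 0` over the support, and the logarithmic
difference splits as `log u - log w + log v - γ G`. Because `v` is updated last, `log v = -γτ (log
g_P - log g_Q)` holds exactly even after finitely many rounds. The row term is at most `γ` after
enough rounds and the gradient term at most `4 M γ`. So `γ` cancels and leaves a bound of order `(1
+ 4 M) / τ`, which strong monotonicity of `log` on `(0, 2]` turns into a bound on `‖g_P - g_Q‖²`.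
Hence `τ₀` is independent of the step sizes (`sum_sq_innerMarginal_sub_le`,
`exists_srProjection_bound`). The bound `M` on the gradient needs the marginals above `δ`, so both
facts are carried through one induction (`almostFeasible_step`, `marginal_gt`).

For smoothness, the objective in `Q` is a sum of quotients of linear forms with denominators above
`δ` (`objective_eq_sum`, `smoothOn_ratioSum`). The `R` block follows by transposition, and the
objective is linear in `T`. -/

namespace FRLC

/-! ### Entrywise multiplicative closeness -/

/-- The nonnegative vectors `x` and `y` agree entrywise up to a factor `exp t`. -/
def LogClose {ι : Type*} (t : ℝ) (x y : ι → ℝ) : Prop :=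
  ∀ i, x i ≤ Real.exp t * y i ∧ y i ≤ Real.exp t * x i

namespace LogClose

variable {ι : Type*} {s t : ℝ} {x y z a : ι → ℝ}

lemma refl (ht : 0 ≤ t) (hx : ∀ i, 0 ≤ x i) : LogClose t x x := fun i =>
  have := le_mul_of_one_le_left (hx i) (Real.one_le_exp ht)
  ⟨this, this⟩

lemma trans (h : LogClose s x y) (h' : LogClose t y z) : LogClose (s + t) x z := by
  intro i
  constructor
  · calc x i ≤ Real.exp s * y i := (h i).1
      _ ≤ Real.exp s * (Real.exp t * z i) := by gcongr; exact (h' i).1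
      _ = Real.exp (s + t) * z i := by rw [Real.exp_add]; ring
  · calc z i ≤ Real.exp t * y i := (h' i).2
      _ ≤ Real.exp t * (Real.exp s * x i) := by gcongr; exact (h i).2
      _ = Real.exp (s + t) * x i := by rw [Real.exp_add]; ring

lemma mono (h : LogClose s x y) (hst : s ≤ t) (hx : ∀ i, 0 ≤ x i) (hy : ∀ i, 0 ≤ y i) :
    LogClose t x y := by
  intro i
  have he := Real.exp_le_exp.2 hst
  exact ⟨(h i).1.trans (mul_le_mul_of_nonneg_right he (hy i)),
    (h i).2.trans (mul_le_mul_of_nonneg_right he (hx i))⟩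

lemma mulVec {n m : ℕ} {K : Matrix (Fin n) (Fin m) ℝ} {x y : Fin m → ℝ}
    (hK : ∀ i j, 0 ≤ K i j) (h : LogClose t x y) : LogClose t (K *ᵥ x) (K *ᵥ y) := by
  intro i
  simp only [Matrix.mulVec, dotProduct, Finset.mul_sum]
  constructor <;> refine Finset.sum_le_sum fun j _ => ?_
  · nlinarith [mul_le_mul_of_nonneg_left (h j).1 (hK i j)]
  · nlinarith [mul_le_mul_of_nonneg_left (h j).2 (hK i j)]

/-- The two-sided hypothesis makes `x` and `y` vanish together, which is compatible with division by
zero giving zero. -/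
lemma div_le_exp_mul_div {a x y : ℝ} (ha : 0 ≤ a) (hx : 0 ≤ x) (hy : 0 ≤ y)
    (h : x ≤ Real.exp t * y) (h' : y ≤ Real.exp t * x) : a / x ≤ Real.exp t * (a / y) := by
  rcases hx.eq_or_lt with rfl | hx
  · simp only [div_zero]; positivity
  have hy : 0 < y := by
    rcases hy.eq_or_lt with rfl | hy
    · simp only [mul_zero] at h; linarith
    · exact hy
  rw [← mul_div_assoc, div_le_div_iff₀ hx hy]
  nlinarith [mul_le_mul_of_nonneg_left h' ha]

lemma div_left (ha : ∀ i, 0 ≤ a i) (hx : ∀ i, 0 ≤ x i) (hy : ∀ i, 0 ≤ y i)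
    (h : LogClose t x y) : LogClose t (fun i => a i / x i) (fun i => a i / y i) := fun i =>
  ⟨div_le_exp_mul_div (ha i) (hx i) (hy i) (h i).1 (h i).2,
    div_le_exp_mul_div (ha i) (hy i) (hx i) (h i).2 (h i).1⟩

lemma rpow (hs : 0 ≤ s) (hx : ∀ i, 0 ≤ x i) (hy : ∀ i, 0 ≤ y i) (h : LogClose t x y) :
    LogClose (s * t) (fun i => x i ^ s) (fun i => y i ^ s) := by
  intro i
  have he : Real.exp (s * t) = Real.exp t ^ s := by rw [mul_comm, Real.exp_mul]
  rw [he, ← Real.mul_rpow (Real.exp_pos t).le (hy i), ← Real.mul_rpow (Real.exp_pos t).le (hx i)]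
  exact ⟨Real.rpow_le_rpow (hx i) (h i).1 hs, Real.rpow_le_rpow (hy i) (h i).2 hs⟩

lemma abs_log_sub_le {i : ι} (h : LogClose t x y) (hx : 0 < x i) (hy : 0 < y i) :
    |Real.log (x i) - Real.log (y i)| ≤ t := by
  have h1 := Real.log_le_log hx (h i).1
  have h2 := Real.log_le_log hy (h i).2
  rw [Real.log_mul (Real.exp_pos t).ne' hy.ne', Real.log_exp] at h1
  rw [Real.log_mul (Real.exp_pos t).ne' hx.ne', Real.log_exp] at h2
  rw [abs_le]
  constructor <;> linarith

lemma abs_sub_le (h : LogClose t x y) (ht : 0 ≤ t) (i : ι) (hy : 0 ≤ y i) :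
    |x i - y i| ≤ (Real.exp t - 1) * y i := by
  have h1 := (h i).1
  have h2 := (h i).2
  have he := Real.one_le_exp ht
  rw [abs_le]
  refine ⟨?_, by linarith⟩
  have h3 : y i / Real.exp t ≤ x i := by
    rw [div_le_iff₀ (Real.exp_pos t)]; linarith
  -- This is `exp t + exp (-t) ≥ 2`, multiplied out as a square.
  have h4 : (2 - Real.exp t) * y i ≤ y i / Real.exp t := by
    rw [le_div_iff₀ (Real.exp_pos t)]
    nlinarith [mul_nonneg hy (sq_nonneg (Real.exp t - 1))]
  linarith

end LogClose

/-! ### The scaling iteration is a contraction -/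

section Scalings

variable {n m : ℕ} {K : Matrix (Fin n) (Fin m) ℝ} {s D : ℝ} {a : Fin n → ℝ} {b : Fin m → ℝ}

lemma mulVec_apply_nonneg {x : Fin m → ℝ} (hK : ∀ i j, 0 ≤ K i j) (hx : ∀ j, 0 ≤ x j)
    (i : Fin n) : 0 ≤ (K *ᵥ x) i := by
  rw [Matrix.mulVec, dotProduct]
  exact Finset.sum_nonneg fun j _ => mul_nonneg (hK i j) (hx j)

lemma mulVec_one_apply (K : Matrix (Fin n) (Fin m) ℝ) (i : Fin n) :
    (K *ᵥ 1) i = ∑ j, K i j := by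
  simp [Matrix.mulVec, dotProduct]

lemma innerMarginal_apply (K : Matrix (Fin n) (Fin m) ℝ) (j : Fin m) :
    innerMarginal K j = ∑ i, K i j := by
  simp [innerMarginal, Matrix.mulVec, dotProduct]

lemma scalings_nonneg (hK : ∀ i j, 0 ≤ K i j) (ha : ∀ i, 0 ≤ a i) (hb : ∀ j, 0 ≤ b j) (l : ℕ) :
    (∀ i, 0 ≤ (scalings K s a b l).1 i) ∧ ∀ j, 0 ≤ (scalings K s a b l).2 j := by
  induction l with
  | zero => exact ⟨fun _ => zero_le_one, fun _ => zero_le_one⟩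
  | succ l ih =>
    have hu : ∀ i, 0 ≤ (scalings K s a b (l + 1)).1 i := fun i =>
      div_nonneg (ha i) (mulVec_apply_nonneg hK ih.2 i)
    exact ⟨hu, fun j => Real.rpow_nonneg
      (div_nonneg (hb j) (mulVec_apply_nonneg (fun i j => hK j i) hu j)) s⟩

/-- Only the power `s` changes the logarithmic distance in a round; the products with `K`, `Kᵀ` and
both divisions do not increase it. -/
lemma scalings_snd_logClose (hK : ∀ i j, 0 ≤ K i j) (ha : ∀ i, 0 ≤ a i) (hb : ∀ j, 0 ≤ b j)
    (hs : 0 ≤ s) (h : LogClose D (scalings K s a b 1).2 1) (l : ℕ) :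
    LogClose (s ^ l * D) (scalings K s a b (l + 1)).2 (scalings K s a b l).2 := by
  induction l with
  | zero => rw [pow_zero, one_mul]; exact h
  | succ l ih =>
    have hn := scalings_nonneg (s := s) hK ha hb
    have hKT : ∀ i j, 0 ≤ Kᵀ i j := fun i j => hK j i
    have hu : LogClose (s ^ l * D) (scalings K s a b (l + 2)).1 (scalings K s a b (l + 1)).1 :=
      (ih.mulVec hK).div_left ha (mulVec_apply_nonneg hK (hn _).2)
        (mulVec_apply_nonneg hK (hn _).2)
    have hv := ((hu.mulVec hKT).div_left hb (mulVec_apply_nonneg hKT (hn _).1)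
      (mulVec_apply_nonneg hKT (hn _).1)).rpow hs
      (fun j => div_nonneg (hb j) (mulVec_apply_nonneg hKT (hn _).1 j))
      (fun j => div_nonneg (hb j) (mulVec_apply_nonneg hKT (hn _).1 j))
    rw [pow_succ', mul_assoc]
    exact hv

/-- Successive distances are summed as a geometric series, giving a bound uniform in `l`. -/
lemma scalings_snd_logClose_one (hK : ∀ i j, 0 ≤ K i j) (ha : ∀ i, 0 ≤ a i)
    (hb : ∀ j, 0 ≤ b j) (hs : 0 ≤ s) (hs1 : s < 1) (hD : 0 ≤ D)
    (h : LogClose D (scalings K s a b 1).2 1) (l : ℕ) :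
    LogClose (D / (1 - s)) (scalings K s a b l).2 1 := by
  have h1 : (1 - s) ≠ 0 := by linarith
  have key : LogClose (D * (1 - s ^ l) / (1 - s)) (scalings K s a b l).2 1 := by
    induction l with
    | zero => exact LogClose.refl (by simp) fun _ => zero_le_one
    | succ l ih =>
      have := (scalings_snd_logClose hK ha hb hs h l).trans ih
      convert this using 1
      field_simp
      ring
  refine key.mono ?_ (scalings_nonneg hK ha hb l).2 fun _ => zero_le_one
  have : 0 < 1 - s := by linarith
  gcongr
  nlinarith [pow_nonneg hs l]

lemma scaled_apply (l : ℕ) (i : Fin n) (j : Fin m) : scaled K s a b l i j =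
    (scalings K s a b l).1 i * K i j * (scalings K s a b l).2 j := by
  simp [scaled]

lemma scaled_nonneg (hK : ∀ i j, 0 ≤ K i j) (ha : ∀ i, 0 ≤ a i) (hb : ∀ j, 0 ≤ b j) (l : ℕ)
    (i : Fin n) (j : Fin m) : 0 ≤ scaled K s a b l i j := by
  rw [scaled_apply]
  have hn := scalings_nonneg (s := s) hK ha hb l
  exact mul_nonneg (mul_nonneg (hn.1 i) (hK i j)) (hn.2 j)

lemma scaled_mulVec_one (l : ℕ) (i : Fin n) : (scaled K s a b l *ᵥ 1) i =
    (scalings K s a b l).1 i * (K *ᵥ (scalings K s a b l).2) i := by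
  rw [mulVec_one_apply]
  simp only [scaled_apply, Matrix.mulVec, dotProduct, Finset.mul_sum, mul_assoc]

lemma innerMarginal_scaled (l : ℕ) (j : Fin m) : innerMarginal (scaled K s a b l) j =
    (Kᵀ *ᵥ (scalings K s a b l).1) j * (scalings K s a b l).2 j := by
  simp only [innerMarginal_apply, scaled_apply, Matrix.mulVec, dotProduct, Finset.sum_mul,
    Matrix.transpose_apply]
  exact Finset.sum_congr rfl fun i _ => by ring

/-- A round ends with the column update, so each column sum is `b j`, or `0` where the denominator
vanishes. One round therefore suffices and convergence plays no role. -/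
lemma sinkhorn_mem_latentDomain {r : ℕ} {K : Matrix (Fin r) (Fin r) ℝ} {a b : Fin r → ℝ}
    (hK : ∀ i j, 0 ≤ K i j) (ha : ∀ i, 0 ≤ a i) (hb : ∀ j, 0 ≤ b j) (hb2 : ∑ j, b j ≤ 2)
    {l : ℕ} (hl : 1 ≤ l) : sinkhorn K a b l ∈ latentDomain r := by
  refine ⟨scaled_nonneg hK ha hb l, ?_⟩
  obtain ⟨l, rfl⟩ := Nat.exists_eq_add_of_le' hl
  refine Finset.sum_comm.trans_le ?_
  refine (Finset.sum_le_sum fun j _ => ?_).trans hb2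
  rw [← innerMarginal_apply, sinkhorn, innerMarginal_scaled]
  change _ * (b j / (Kᵀ *ᵥ (scalings K 1 a b (l + 1)).1) j) ^ (1 : ℝ) ≤ b j
  rw [Real.rpow_one]
  by_cases h : (Kᵀ *ᵥ (scalings K 1 a b (l + 1)).1) j = 0
  · rw [h]; simpa using hb j
  · rw [mul_div_cancel₀ _ h]

end Scalings

/-! ### One semi-relaxed projection -/

/-- Data of a semi-relaxed projection: a nonnegative matrix `Q` with positive column sums whose
row sums are close to the probability vector `a`, and a direction `G` bounded by `M`. -/
structure ProjectionData {n r : ℕ} (Q G : Matrix (Fin n) (Fin r) ℝ) (a : Fin n → ℝ)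
    (M η : ℝ) : Prop where
  nonneg : ∀ i j, 0 ≤ Q i j
  row_nonneg : ∀ i, 0 ≤ a i
  row_sum : ∑ i, a i = 1
  dir_le : ∀ i j, |G i j| ≤ M
  close : LogClose η (Q *ᵥ 1) a
  col_pos : ∀ j, 0 < innerMarginal Q j

lemma exp_half_le_two : Real.exp (1 / 2) ≤ 2 := by
  have h : Real.exp (1 / 2) * Real.exp (1 / 2) = Real.exp 1 := by
    rw [← Real.exp_add]; norm_num
  have := Real.exp_one_lt_d9
  nlinarith [Real.exp_pos (1 / 2)]

lemma exp_sub_one_le {η : ℝ} (h0 : 0 ≤ η) (h1 : η ≤ 1 / 2) : Real.exp η - 1 ≤ 2 * η := by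
  have h := Real.add_one_le_exp (-η)
  have h2 : Real.exp (-η) * Real.exp η = 1 := by rw [← Real.exp_add]; simp
  nlinarith [Real.exp_pos η]

namespace ProjectionData

variable {n r : ℕ} {Q G : Matrix (Fin n) (Fin r) ℝ} {a : Fin n → ℝ} {M η γ s t : ℝ}

lemma rowSum_nonneg (h : ProjectionData Q G a M η) (i : Fin n) : 0 ≤ (Q *ᵥ 1) i :=
  mulVec_apply_nonneg h.nonneg (fun _ => zero_le_one) i

lemma eq_zero_of_row (h : ProjectionData Q G a M η) {i : Fin n} (hi : a i = 0) (j : Fin r) :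
    Q i j = 0 := by
  have h1 := (h.close i).1
  rw [hi, mul_zero, mulVec_one_apply] at h1
  exact le_antisymm ((Finset.single_le_sum (fun j _ => h.nonneg i j)
    (Finset.mem_univ j)).trans h1) (h.nonneg i j)

lemma rowSum_pos (h : ProjectionData Q G a M η) {i : Fin n} (hi : 0 < a i) :
    0 < (Q *ᵥ 1) i := by
  have h1 := (h.close i).2
  by_contra hc
  nlinarith [Real.exp_pos η, mul_nonpos_of_nonneg_of_nonpos (Real.exp_pos η).le (not_lt.1 hc)]

lemma row_eq_zero (h : ProjectionData Q G a M η) {i : Fin n} (hi : (Q *ᵥ 1) i = 0) :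
    a i = 0 := by
  rcases (h.row_nonneg i).eq_or_lt with h0 | h0
  · exact h0.symm
  · exact absurd hi (h.rowSum_pos h0).ne'

lemma kernel_nonneg (h : ProjectionData Q G a M η) (i : Fin n) (j : Fin r) :
    0 ≤ mdKernel Q G γ i j :=
  mul_nonneg (h.nonneg i j) (Real.exp_pos _).le

lemma kernel_logClose (h : ProjectionData Q G a M η) (hγ : 0 ≤ γ) (i : Fin n) (j : Fin r) :
    mdKernel Q G γ i j ≤ Real.exp (γ * M) * Q i j ∧
      Q i j ≤ Real.exp (γ * M) * mdKernel Q G γ i j := by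
  have hG := abs_le.1 (h.dir_le i j)
  have hq := h.nonneg i j
  simp only [mdKernel, Matrix.of_apply]
  constructor
  · rw [mul_comm (Real.exp (γ * M))]
    exact mul_le_mul_of_nonneg_left (Real.exp_le_exp.2 (by nlinarith)) hq
  · rw [mul_left_comm, ← Real.exp_add]
    refine le_mul_of_one_le_right hq (Real.one_le_exp ?_)
    nlinarith

lemma kernel_mulVec_logClose (h : ProjectionData Q G a M η) (hγ : 0 ≤ γ) {x : Fin r → ℝ}
    (hx : ∀ j, 0 ≤ x j) : LogClose (γ * M) (mdKernel Q G γ *ᵥ x) (Q *ᵥ x) := by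
  intro i
  simp only [Matrix.mulVec, dotProduct, Finset.mul_sum]
  constructor <;> refine Finset.sum_le_sum fun j _ => ?_ <;> rw [← mul_assoc]
  · exact mul_le_mul_of_nonneg_right (h.kernel_logClose hγ i j).1 (hx j)
  · exact mul_le_mul_of_nonneg_right (h.kernel_logClose hγ i j).2 (hx j)

lemma kernel_transpose_mulVec_logClose (h : ProjectionData Q G a M η) (hγ : 0 ≤ γ)
    {x : Fin n → ℝ} (hx : ∀ j, 0 ≤ x j) :
    LogClose (γ * M) ((mdKernel Q G γ)ᵀ *ᵥ x) (Qᵀ *ᵥ x) := by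
  intro j
  simp only [Matrix.mulVec, dotProduct, Finset.mul_sum, Matrix.transpose_apply]
  constructor <;> refine Finset.sum_le_sum fun i _ => ?_ <;> rw [← mul_assoc]
  · exact mul_le_mul_of_nonneg_right (h.kernel_logClose hγ i j).1 (hx i)
  · exact mul_le_mul_of_nonneg_right (h.kernel_logClose hγ i j).2 (hx i)

/-- The row scaling that corrects the row sums of `Q` to `a`. -/
noncomputable def rowScaling (Q : Matrix (Fin n) (Fin r) ℝ) (a : Fin n → ℝ) : Fin n → ℝ :=
  fun i => a i / (Q *ᵥ 1) i

lemma rowScaling_nonneg (h : ProjectionData Q G a M η) (i : Fin n) : 0 ≤ rowScaling Q a i :=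
  div_nonneg (h.row_nonneg i) (h.rowSum_nonneg i)

/-- Correcting the rows changes each entry by a factor at most `exp η`; rows with `a i = 0` are
already zero. -/
lemma transpose_mulVec_rowScaling_logClose (h : ProjectionData Q G a M η) :
    LogClose η (Qᵀ *ᵥ rowScaling Q a) (innerMarginal Q) := by
  have key : ∀ i j, Q i j * rowScaling Q a i ≤ Real.exp η * Q i j ∧
      Q i j ≤ Real.exp η * (Q i j * rowScaling Q a i) := by
    intro i j
    rcases (h.row_nonneg i).eq_or_lt with hi | hi
    · simp [h.eq_zero_of_row hi.symm j]
    have hp := h.rowSum_pos hi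
    have h1 : rowScaling Q a i ≤ Real.exp η := (div_le_iff₀ hp).2 (h.close i).2
    have h2 : 1 ≤ Real.exp η * rowScaling Q a i := by
      rw [rowScaling, ← mul_div_assoc, le_div_iff₀ hp, one_mul]
      exact (h.close i).1
    constructor
    · nlinarith [h.nonneg i j]
    · nlinarith [h.nonneg i j]
  intro j
  simp only [innerMarginal_apply, Matrix.mulVec, dotProduct, Finset.mul_sum,
    Matrix.transpose_apply]
  exact ⟨Finset.sum_le_sum fun i _ => (key i j).1, Finset.sum_le_sum fun i _ => (key i j).2⟩

lemma scalings_fst_logClose (h : ProjectionData Q G a M η) (hγ : 0 ≤ γ) {l : ℕ}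
    (hv : LogClose t (scalings (mdKernel Q G γ) s a (innerMarginal Q) l).2 1) :
    LogClose (t + γ * M) (scalings (mdKernel Q G γ) s a (innerMarginal Q) (l + 1)).1
      (rowScaling Q a) := by
  have hn := (scalings_nonneg (s := s) (h.kernel_nonneg (γ := γ)) h.row_nonneg
    (fun j => (h.col_pos j).le) l).2
  exact ((hv.mulVec h.kernel_nonneg).trans
    (h.kernel_mulVec_logClose hγ fun _ => zero_le_one)).div_left h.row_nonneg
      (mulVec_apply_nonneg h.kernel_nonneg hn) h.rowSum_nonneg

/-- Supplies the initial distance of the contraction. The kernel differs from `Q` by a factor `exp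
(γ * M)`, once in `u` and once in `Kᵀ u`, and `η` accounts for the row correction. With `Q` itself
and exact rows the first `v` would be `1`. -/
lemma scalings_one_logClose (h : ProjectionData Q G a M η) (hγ : 0 ≤ γ) (hs : 0 ≤ s) :
    LogClose (s * (γ * M + γ * M + η))
      (scalings (mdKernel Q G γ) s a (innerMarginal Q) 1).2 1 := by
  have hn := (scalings_nonneg (s := s) (h.kernel_nonneg (γ := γ)) h.row_nonneg
    (fun j => (h.col_pos j).le) 1).1
  have hKT : ∀ j i, 0 ≤ (mdKernel Q G γ)ᵀ j i := fun j i => h.kernel_nonneg i j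
  have h0 := h.scalings_fst_logClose (s := s) (l := 0) hγ
    (LogClose.refl le_rfl fun _ => zero_le_one)
  rw [zero_add] at h0
  have h1 := ((h0.mulVec hKT).trans (h.kernel_transpose_mulVec_logClose hγ
    h.rowScaling_nonneg)).trans h.transpose_mulVec_rowScaling_logClose
  have h2 := (h1.div_left (fun j => (h.col_pos j).le) (mulVec_apply_nonneg hKT hn)
    (fun j => (h.col_pos j).le)).rpow hs
      (fun j => div_nonneg (h.col_pos j).le (mulVec_apply_nonneg hKT hn j))
      (fun j => div_nonneg (h.col_pos j).le (h.col_pos j).le)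
  have e : (fun j => (innerMarginal Q j / innerMarginal Q j) ^ s) = 1 := by
    funext j
    rw [div_self (h.col_pos j).ne', Real.one_rpow, Pi.one_apply]
  rw [e] at h2
  exact h2

end ProjectionData

/-! ### Positivity and monotonicity inequalities for the logarithm -/

lemma pos_of_logClose_one {ι : Type*} {t : ℝ} {v : ι → ℝ} (h : LogClose t v 1) (j : ι) :
    0 < v j := by
  have := (h j).2
  rw [Pi.one_apply] at this
  by_contra hc
  nlinarith [Real.exp_pos t, mul_nonpos_of_nonneg_of_nonpos (Real.exp_pos t).le (not_lt.1 hc)]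

lemma sub_mul_log_sub_log_nonneg {x y : ℝ} (hx : 0 < x) (hy : 0 < y) :
    0 ≤ (x - y) * (Real.log x - Real.log y) := by
  rcases le_total x y with h | h
  · nlinarith [Real.log_le_log hx h]
  · nlinarith [Real.log_le_log hy h]

/-- On `(0, 2]` the derivative of `log` is at least `1 / 2`. -/
lemma sq_sub_le_mul_log_sub_log {x y : ℝ} (hx : 0 < x) (hy : 0 < y) (hx2 : x ≤ 2)
    (hy2 : y ≤ 2) : (x - y) ^ 2 ≤ 2 * ((x - y) * (Real.log x - Real.log y)) := by
  have key : ∀ x y : ℝ, 0 < x → 0 < y → x ≤ 2 → y ≤ x →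
      (x - y) ^ 2 ≤ 2 * ((x - y) * (Real.log x - Real.log y)) := by
    intro x y hx hy hx2 h
    have h1 := Real.log_le_sub_one_of_pos (div_pos hy hx)
    rw [Real.log_div hy.ne' hx.ne'] at h1
    have h2 : y / x - 1 ≤ (y - x) / 2 := by
      rw [div_sub_one hx.ne', div_le_div_iff₀ hx two_pos]
      nlinarith
    nlinarith
  rcases le_total x y with h | h
  · linarith [key y x hy hx hy2 h, sub_mul_log_sub_log_nonneg hx hy]
  · exact key x y hx hy hx2 h

/-! ### Energy inequality and the change of the inner marginal -/

namespace ProjectionData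

variable {n r : ℕ} {Q G : Matrix (Fin n) (Fin r) ℝ} {a : Fin n → ℝ} {M η γ s t : ℝ}

/-- Monotonicity of `log`, applied entrywise to `diag(u) K diag(v)` and `diag(w) Q` and regrouped by
rows, columns and direction. Entries with `Q i j = 0` contribute nothing, so positivity of `u` and
`w` matters only where `a` is positive. -/
lemma energy_nonneg (h : ProjectionData Q G a M η) {u w : Fin n → ℝ} {v : Fin r → ℝ}
    (hu : ∀ i, 0 < a i → 0 < u i) (hw : ∀ i, 0 < a i → 0 < w i) (hv : ∀ j, 0 < v j) :
    0 ≤ ∑ i, (Real.log (u i) - Real.log (w i)) *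
          (∑ j, u i * mdKernel Q G γ i j * v j - ∑ j, Q i j * w i) +
        ∑ j, Real.log (v j) * (∑ i, u i * mdKernel Q G γ i j * v j - ∑ i, Q i j * w i) -
        γ * ∑ i, ∑ j, G i j * (u i * mdKernel Q G γ i j * v j - Q i j * w i) := by
  have key : 0 ≤ ∑ i, ∑ j, (u i * mdKernel Q G γ i j * v j - Q i j * w i) *
      (Real.log (u i) - Real.log (w i) + Real.log (v j) - γ * G i j) := by
    refine Finset.sum_nonneg fun i _ => Finset.sum_nonneg fun j _ => ?_
    rcases (h.nonneg i j).eq_or_lt with hq | hq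
    · simp [mdKernel, ← hq]
    have ha : 0 < a i := (h.row_nonneg i).lt_of_ne' fun h0 => hq.ne' (h.eq_zero_of_row h0 j)
    have hui := hu i ha
    have hwi := hw i ha
    have hvj := hv j
    have hk : 0 < mdKernel Q G γ i j := mul_pos hq (Real.exp_pos _)
    have e : Real.log (u i) - Real.log (w i) + Real.log (v j) - γ * G i j =
        Real.log (u i * mdKernel Q G γ i j * v j) - Real.log (Q i j * w i) := by
      rw [Real.log_mul (by positivity) hvj.ne', Real.log_mul hui.ne' hk.ne',
        Real.log_mul hq.ne' hwi.ne', mdKernel, Matrix.of_apply,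
        Real.log_mul hq.ne' (Real.exp_pos _).ne', Real.log_exp]
      ring
    rw [e]
    exact sub_mul_log_sub_log_nonneg (by positivity) (by positivity)
  refine key.trans_eq ?_
  have e2 : ∑ j, Real.log (v j) * (∑ i, u i * mdKernel Q G γ i j * v j - ∑ i, Q i j * w i) =
      ∑ i, ∑ j, Real.log (v j) * (u i * mdKernel Q G γ i j * v j - Q i j * w i) := by
    rw [Finset.sum_comm]
    simp only [← Finset.sum_sub_distrib, Finset.mul_sum]
  rw [e2]
  simp only [← Finset.sum_sub_distrib, Finset.mul_sum, ← Finset.sum_add_distrib]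
  exact Finset.sum_congr rfl fun i _ => Finset.sum_congr rfl fun j _ => by ring

lemma sum_innerMarginal_le {P : Matrix (Fin n) (Fin r) ℝ} (h : LogClose t (P *ᵥ 1) a)
    (ha : ∑ i, a i = 1) (ht : t ≤ 1 / 2) : ∑ j, innerMarginal P j ≤ 2 := by
  have e : ∑ j, innerMarginal P j = ∑ i, (P *ᵥ 1) i := by
    simp only [innerMarginal_apply, mulVec_one_apply]
    exact Finset.sum_comm
  rw [e]
  calc ∑ i, (P *ᵥ 1) i ≤ ∑ i, Real.exp t * a i := Finset.sum_le_sum fun i _ => (h i).1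
    _ = Real.exp t := by rw [← Finset.mul_sum, ha, mul_one]
    _ ≤ 2 := (Real.exp_le_exp.2 ht).trans exp_half_le_two

/-- The last `u` was computed from the preceding `v`, so the row sums are `a * (K v_{l+1}) / (K
v_l)` and inherit the distance between consecutive `v`. Closeness of `v_l` to `1` keeps the
denominator positive where `a` is. -/
lemma scaled_mulVec_one_logClose (h : ProjectionData Q G a M η) {D : ℝ} {l : ℕ} (hs : 0 ≤ s)
    (hD : LogClose D (scalings (mdKernel Q G γ) s a (innerMarginal Q) 1).2 1)
    (hl : LogClose t (scalings (mdKernel Q G γ) s a (innerMarginal Q) l).2 1) :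
    LogClose (s ^ l * D) (scaled (mdKernel Q G γ) s a (innerMarginal Q) (l + 1) *ᵥ 1) a := by
  set K := mdKernel Q G γ
  set v := fun k => (scalings K s a (innerMarginal Q) k).2
  have hc : LogClose (s ^ l * D) (K *ᵥ v (l + 1)) (K *ᵥ v l) :=
    (scalings_snd_logClose h.kernel_nonneg h.row_nonneg (fun j => (h.col_pos j).le) hs
      hD l).mulVec h.kernel_nonneg
  have hvl := pos_of_logClose_one hl
  intro i
  rw [scaled_mulVec_one]
  change a i / (K *ᵥ v l) i * (K *ᵥ v (l + 1)) i ≤ _ ∧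
    _ ≤ _ * (a i / (K *ᵥ v l) i * (K *ᵥ v (l + 1)) i)
  rcases (h.row_nonneg i).eq_or_lt with h0 | h0
  · simp [← h0]
  have hk : 0 < (K *ᵥ v l) i := by
    have hp := h.rowSum_pos h0
    rw [mulVec_one_apply] at hp
    obtain ⟨j, -, hj⟩ := Finset.exists_lt_of_sum_lt (s := Finset.univ) (f := fun _ => (0 : ℝ))
      (by simpa using hp)
    exact Finset.sum_pos' (fun j _ => mul_nonneg (h.kernel_nonneg i j) (hvl j).le)
      ⟨j, Finset.mem_univ j, mul_pos (mul_pos hj (Real.exp_pos _)) (hvl j)⟩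
  constructor
  · rw [div_mul_eq_mul_div, div_le_iff₀ hk]
    nlinarith [(hc i).1]
  · rw [← mul_assoc, ← mul_div_assoc, div_mul_eq_mul_div, le_div_iff₀ hk]
    nlinarith [(hc i).2]

lemma sum_sq_innerMarginal_sub_le (h : ProjectionData Q G a M η) {τ t c : ℝ} {l : ℕ}
    (hM : 0 ≤ M) (hη : 0 ≤ η) (hη2 : η ≤ 1 / 2) (hγ : 0 < γ) (hτ : 0 < τ)
    (ht : 0 ≤ t) (ht2 : t ≤ 1 / 2) (hc : 0 ≤ c) (hct : (c + γ * M) * (2 * t) ≤ γ)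
    (hP : LogClose t (srProjection (mdKernel Q G γ) γ τ a (innerMarginal Q) (l + 1) *ᵥ 1) a)
    (hl : ∀ l, LogClose c
      (scalings (mdKernel Q G γ) (τ / (τ + γ⁻¹)) a (innerMarginal Q) l).2 1) :
    ∑ j, (innerMarginal (srProjection (mdKernel Q G γ) γ τ a (innerMarginal Q) (l + 1)) j -
      innerMarginal Q j) ^ 2 ≤ 4 * (1 + 4 * M) / τ + 32 * η := by
  have hcol : ∀ j, 0 ≤ innerMarginal Q j := fun j => (h.col_pos j).le
  set s := τ / (τ + γ⁻¹) with hsdef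
  set K := mdKernel Q G γ with hK
  set q := innerMarginal Q with hq
  set w := rowScaling Q a with hw
  set u := (scalings K s a q (l + 1)).1 with hu
  set v := (scalings K s a q (l + 1)).2 with hv
  set P := srProjection K γ τ a q (l + 1) with hPdef
  have hγi : 0 < γ⁻¹ := inv_pos.2 hγ
  have hs : 0 < s := by positivity
  have hst : γ * τ * (1 - s) = s := by
    rw [hsdef]; field_simp; ring
  have hKn : ∀ i j, 0 ≤ K i j := h.kernel_nonneg
  have hn := scalings_nonneg (s := s) hKn h.row_nonneg hcol (l + 1)
  have hvp : ∀ j, 0 < v j := pos_of_logClose_one (hl (l + 1))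
  have huw : LogClose (c + γ * M) u w := h.scalings_fst_logClose hγ.le (hl l)
  have hwp : ∀ i, 0 < a i → 0 < w i := fun i hi => div_pos hi (h.rowSum_pos hi)
  have hup : ∀ i, 0 < a i → 0 < u i := by
    intro i hi
    have := (huw i).2
    by_contra hcon
    nlinarith [hwp i hi, Real.exp_pos (c + γ * M),
      mul_nonpos_of_nonneg_of_nonpos (Real.exp_pos (c + γ * M)).le (not_lt.1 hcon)]
  have hPa : ∀ i j, P i j = u i * K i j * v j := fun i j => scaled_apply _ _ _
  have hPn : ∀ i j, 0 ≤ P i j := fun i j => by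
    rw [hPa]; exact mul_nonneg (mul_nonneg (hn.1 i) (hKn i j)) (hn.2 j)
  set k := Kᵀ *ᵥ u with hk
  have hvk : ∀ j, v j = (q j / k j) ^ s := fun j => rfl
  -- A zero denominator would give `v j = 0` by the division convention, but `v` is positive.
  have hkp : ∀ j, 0 < k j := by
    intro j
    have h0 : 0 ≤ k j := mulVec_apply_nonneg (fun j i => hKn i j) hn.1 j
    refine h0.lt_of_ne' fun h1 => (hvp j).ne' ?_
    rw [hvk, h1, div_zero, Real.zero_rpow hs.ne']
  set g := innerMarginal P with hg
  set gt := Qᵀ *ᵥ w with hgt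
  have hgk : ∀ j, g j = k j * v j := fun j => innerMarginal_scaled _ _
  have hgp : ∀ j, 0 < g j := fun j => by rw [hgk]; exact mul_pos (hkp j) (hvp j)
  -- The optimality condition of the relaxed column penalty. It holds without convergence because
  -- the column update comes last; `hst` encodes the choice of exponent.
  have hlog : ∀ j, Real.log (v j) = -(γ * τ) * (Real.log (g j) - Real.log (q j)) := by
    intro j
    have e : Real.log (v j) = s * (Real.log (q j) - Real.log (k j)) := by
      rw [hvk, Real.log_rpow (div_pos (h.col_pos j) (hkp j)),
        Real.log_div (h.col_pos j).ne' (hkp j).ne']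
    rw [hgk, Real.log_mul (hkp j).ne' (hvp j).ne', e]
    linear_combination (Real.log (k j) - Real.log (q j)) * hst
  have hgtq : LogClose η gt q := h.transpose_mulVec_rowScaling_logClose
  have hgtp : ∀ j, 0 < gt j := by
    intro j
    have := (hgtq j).2
    by_contra hcon
    nlinarith [h.col_pos j, mul_nonpos_of_nonneg_of_nonpos (Real.exp_pos η).le (not_lt.1 hcon)]
  have hrow : ∀ i, ∑ j, Q i j * w i = a i := by
    intro i
    rw [← Finset.sum_mul, ← mulVec_one_apply, hw, rowScaling]
    by_cases h0 : (Q *ᵥ 1) i = 0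
    · rw [h0, zero_mul, h.row_eq_zero h0]
    · exact mul_div_cancel₀ _ h0
  have hgta : ∀ j, gt j = ∑ i, Q i j * w i := fun j => rfl
  have hga : ∀ j, g j = ∑ i, u i * K i j * v j := fun j => by
    rw [hg, innerMarginal_apply]; exact Finset.sum_congr rfl fun i _ => hPa i j
  have hPr : ∀ i, (P *ᵥ 1) i = ∑ j, u i * K i j * v j := fun i => by
    rw [mulVec_one_apply]; exact Finset.sum_congr rfl fun j _ => hPa i j
  have hgs : ∑ j, g j ≤ 2 := sum_innerMarginal_le hP h.row_sum ht2
  have hqs : ∑ j, q j ≤ 2 := sum_innerMarginal_le h.close h.row_sum hη2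
  have hgts : ∑ j, gt j = 1 := by
    simp only [hgta]
    rw [Finset.sum_comm, ← h.row_sum]
    exact Finset.sum_congr rfl fun i _ => hrow i
  have hg2 : ∀ j, g j ≤ 2 := fun j =>
    (Finset.single_le_sum (fun j _ => (hgp j).le) (Finset.mem_univ j)).trans hgs
  have hq2 : ∀ j, q j ≤ 2 := fun j =>
    (Finset.single_le_sum (fun j _ => hcol j) (Finset.mem_univ j)).trans hqs
  have hgt2 : ∀ j, gt j ≤ 2 := fun j =>
    (Finset.single_le_sum (fun j _ => (hgtp j).le) (Finset.mem_univ j)).trans (by linarith)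
  have hE := h.energy_nonneg (γ := γ) hup hwp hvp
  simp only [hrow, ← hK, ← hPr, ← hga, ← hgta, hlog] at hE
  -- The only cost of stopping early: a bounded logarithmic ratio times a row error that `hct` makes
  -- small relative to `γ`.
  have hfirst : ∑ i, (Real.log (u i) - Real.log (w i)) * ((P *ᵥ 1) i - a i) ≤ γ := by
    calc ∑ i, (Real.log (u i) - Real.log (w i)) * ((P *ᵥ 1) i - a i)
        ≤ ∑ i, (c + γ * M) * (2 * t) * a i := by
          refine Finset.sum_le_sum fun i _ => ?_
          rcases (h.row_nonneg i).eq_or_lt with h0 | h0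
          · have := hP.abs_sub_le ht i (h.row_nonneg i)
            rw [← h0, mul_zero, sub_zero, abs_nonpos_iff] at this
            rw [this, ← h0]; simp
          · refine (le_abs_self _).trans ?_
            rw [abs_mul, mul_assoc]
            refine mul_le_mul (huw.abs_log_sub_le (hup i h0) (hwp i h0)) ?_ (abs_nonneg _)
              (by positivity)
            exact (hP.abs_sub_le ht i h0.le).trans
              (mul_le_mul_of_nonneg_right (exp_sub_one_le ht ht2) h0.le)
      _ = (c + γ * M) * (2 * t) := by rw [← Finset.mul_sum, h.row_sum, mul_one]
      _ ≤ γ := hct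
  have hthird : -(∑ i, ∑ j, G i j * (u i * K i j * v j - Q i j * w i)) ≤ 4 * M := by
    rw [← Finset.sum_neg_distrib]
    calc ∑ i, -∑ j, G i j * (u i * K i j * v j - Q i j * w i)
        ≤ ∑ i, ∑ j, M * (P i j + Q i j * w i) := by
          refine Finset.sum_le_sum fun i _ => ?_
          rw [← Finset.sum_neg_distrib]
          refine Finset.sum_le_sum fun j _ => ?_
          rw [← hPa]
          have hG := abs_le.1 (h.dir_le i j)
          nlinarith [hPn i j, mul_nonneg (h.nonneg i j) (h.rowScaling_nonneg i)]
      _ = M * (∑ j, g j + ∑ j, gt j) := by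
          simp only [hg, innerMarginal_apply, hgta, ← Finset.mul_sum, Finset.sum_add_distrib]
          congr 2 <;> exact Finset.sum_comm
      _ ≤ 4 * M := by rw [hgts]; nlinarith
  -- Every term of the energy inequality is now at most a multiple of `γ`, which cancels.
  have hmain : ∑ j, (g j - gt j) * (Real.log (g j) - Real.log (q j)) ≤ (1 + 4 * M) / τ := by
    have e : ∑ j, -(γ * τ) * (Real.log (g j) - Real.log (q j)) * (g j - gt j) =
        -(γ * τ) * ∑ j, (g j - gt j) * (Real.log (g j) - Real.log (q j)) := by
      rw [Finset.mul_sum]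
      exact Finset.sum_congr rfl fun j _ => by ring
    rw [e] at hE
    rw [le_div_iff₀ hτ]
    refine le_of_mul_le_mul_left ?_ hγ
    nlinarith
  -- Splits `g - q` through the corrected marginal `gt`; replacing `log gt` by `log q` costs the `η`
  -- terms.
  have hterm : ∀ j, (g j - q j) ^ 2 ≤
      4 * ((g j - gt j) * (Real.log (g j) - Real.log (q j))) + 4 * η * (g j + gt j) +
        8 * η * q j := by
    intro j
    have h1 := sq_sub_le_mul_log_sub_log (hgp j) (hgtp j) (hg2 j) (hgt2 j)
    have h2 : (g j - gt j) * (Real.log (q j) - Real.log (gt j)) ≤ η * (g j + gt j) := by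
      have h3 := hgtq.abs_log_sub_le (hgtp j) (h.col_pos j)
      refine (le_abs_self _).trans ?_
      rw [abs_mul, abs_sub_comm (Real.log (q j)), mul_comm]
      refine mul_le_mul h3 ?_ (abs_nonneg _) hη
      rw [abs_le]
      constructor <;> linarith [hgp j, hgtp j]
    have h4 : (gt j - q j) ^ 2 ≤ 4 * η * q j := by
      have h5 := hgtq.abs_sub_le hη j (hcol j)
      have h6 : |gt j - q j| ≤ 2 * η * q j :=
        h5.trans (mul_le_mul_of_nonneg_right (exp_sub_one_le hη hη2) (hcol j))
      rw [← sq_abs]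
      calc |gt j - q j| ^ 2 ≤ (2 * η * q j) ^ 2 := by gcongr
        _ = 4 * η * q j * (η * q j) := by ring
        _ ≤ 4 * η * q j * 1 := by
          gcongr
          · have := hcol j; positivity
          · nlinarith [hq2 j, hcol j]
        _ = 4 * η * q j := mul_one _
    nlinarith [sq_nonneg ((g j - gt j) - (gt j - q j))]
  calc ∑ j, (g j - q j) ^ 2 ≤ _ := Finset.sum_le_sum fun j _ => hterm j
    _ = 4 * ∑ j, (g j - gt j) * (Real.log (g j) - Real.log (q j)) +
        4 * η * (∑ j, g j + ∑ j, gt j) + 8 * η * ∑ j, q j := by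
      simp only [Finset.sum_add_distrib, ← Finset.mul_sum]
    _ ≤ 4 * (1 + 4 * M) / τ + 32 * η := by
      rw [mul_div_assoc, hgts]
      nlinarith

end ProjectionData

lemma exists_srProjection_bound (n r : ℕ) {M η γ τ : ℝ} (hM : 0 ≤ M) (hη : 0 < η)
    (hη2 : η ≤ 1 / 2) (hγ : 0 < γ) (hτ : 0 < τ) :
    ∃ L : ℕ, ∀ (Q G : Matrix (Fin n) (Fin r) ℝ) (a : Fin n → ℝ), ProjectionData Q G a M η →
      ∀ l ≥ L, ∀ P, P = srProjection (mdKernel Q G γ) γ τ a (innerMarginal Q) l →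
        (∀ i j, 0 ≤ P i j) ∧ LogClose η (P *ᵥ 1) a ∧
        ∑ j, (innerMarginal P j - innerMarginal Q j) ^ 2 ≤ 4 * (1 + 4 * M) / τ + 32 * η := by
  set s := τ / (τ + γ⁻¹) with hs
  have hγi : 0 < γ⁻¹ := inv_pos.2 hγ
  have hs0 : 0 < s := by positivity
  have hs1 : s < 1 := by rw [hs, div_lt_one (by positivity)]; linarith
  set D := s * (γ * M + γ * M + η) with hD
  have hD0 : 0 ≤ D := by positivity
  have hs1' : 0 < 1 - s := by linarith
  set c := D / (1 - s) with hc
  have hc0 : 0 ≤ c := by positivity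
  have hlim : Filter.Tendsto (fun l : ℕ => s ^ l * D) Filter.atTop (nhds 0) := by
    simpa using (tendsto_pow_atTop_nhds_zero_of_lt_one hs0.le hs1).mul_const D
  -- The first bound preserves the row tolerance, the second gives the smallness required in `hct`;
  -- the `+ 1` keeps the denominator positive.
  have hpos : 0 < min η (γ / (2 * (c + γ * M + 1))) := lt_min hη (by positivity)
  obtain ⟨L, hL⟩ := Filter.eventually_atTop.1 (hlim.eventually_le_const hpos)
  refine ⟨L + 1, fun Q G a h l hl P hP => ?_⟩
  obtain ⟨l, rfl⟩ := Nat.exists_eq_add_of_le' (le_of_add_le_right hl)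
  have hbound := hL l (by omega)
  have ht0 : 0 ≤ s ^ l * D := by positivity
  have htη : s ^ l * D ≤ η := hbound.trans (min_le_left _ _)
  have htc : (c + γ * M) * (2 * (s ^ l * D)) ≤ γ := by
    have h1 := hbound.trans (min_le_right _ _)
    rw [le_div_iff₀ (by positivity)] at h1
    nlinarith
  have hcol : ∀ j, 0 ≤ innerMarginal Q j := fun j => (h.col_pos j).le
  have h1 := h.scalings_one_logClose hγ.le hs0.le
  have hv := scalings_snd_logClose_one (K := mdKernel Q G γ) h.kernel_nonneg h.row_nonneg hcol
    hs0.le hs1 hD0 h1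
  have hrow := h.scaled_mulVec_one_logClose hs0.le h1 (hv l)
  have hPn := scaled_nonneg (s := s) (h.kernel_nonneg (γ := γ)) h.row_nonneg hcol (l + 1)
  subst hP
  refine ⟨hPn, hrow.mono htη (fun i => mulVec_apply_nonneg hPn (fun _ => zero_le_one) i)
    h.row_nonneg, ?_⟩
  exact h.sum_sq_innerMarginal_sub_le hM hη.le hη2 hγ hτ ht0 (htη.trans hη2) hc0 htc hrow hv

/-! ### The objective and its gradient in one factor -/

variable {n m r : ℕ}

lemma norm_sq_eq_sum (A : Matrix (Fin n) (Fin m) ℝ) : ‖A‖ ^ 2 = ∑ i, ∑ j, A i j ^ 2 := by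
  have h0 : 0 ≤ ∑ i, ∑ j, A i j ^ 2 :=
    Finset.sum_nonneg fun i _ => Finset.sum_nonneg fun j _ => sq_nonneg _
  rw [Matrix.frobenius_norm_def]
  simp only [Real.norm_eq_abs, Real.rpow_two, sq_abs]
  rw [← Real.sqrt_eq_rpow, Real.sq_sqrt h0]

lemma abs_apply_le_norm (A : Matrix (Fin n) (Fin m) ℝ) (i : Fin n) (j : Fin m) :
    |A i j| ≤ ‖A‖ := by
  refine abs_le_of_sq_le_sq ?_ (norm_nonneg _)
  rw [norm_sq_eq_sum]
  refine (Finset.single_le_sum (f := fun j => A i j ^ 2) (fun j _ => sq_nonneg _)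
    (Finset.mem_univ j)).trans ?_
  exact Finset.single_le_sum (f := fun i => ∑ j, A i j ^ 2)
    (fun i _ => Finset.sum_nonneg fun j _ => sq_nonneg _) (Finset.mem_univ i)

lemma norm_le_sum_abs (A : Matrix (Fin n) (Fin m) ℝ) : ‖A‖ ≤ ∑ i, ∑ j, |A i j| := by
  have h0 : 0 ≤ ∑ i, ∑ j, |A i j| :=
    Finset.sum_nonneg fun i _ => Finset.sum_nonneg fun j _ => abs_nonneg _
  refine abs_le_of_sq_le_sq' ?_ h0 |>.2
  rw [norm_sq_eq_sum]
  simp only [← Finset.sum_product', ← sq_abs (A _ _)]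
  exact Finset.sum_sq_le_sq_sum_of_nonneg fun _ _ => abs_nonneg _

/-- The matrix `C R diag(1/g_R) Tᵀ`, for which `C R Xᵀ = factorWeight C R T * diag(1/g_Q)`. -/
noncomputable def factorWeight (C : Matrix (Fin n) (Fin m) ℝ) (R : Matrix (Fin m) (Fin r) ℝ)
    (T : Matrix (Fin r) (Fin r) ℝ) : Matrix (Fin n) (Fin r) ℝ :=
  C * R * Matrix.diagonal (fun j => 1 / innerMarginal R j) * Tᵀ

lemma mul_innerMatrix_transpose_apply (C : Matrix (Fin n) (Fin m) ℝ)
    (Q : Matrix (Fin n) (Fin r) ℝ) (R : Matrix (Fin m) (Fin r) ℝ) (T : Matrix (Fin r) (Fin r) ℝ)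
    (i : Fin n) (j : Fin r) :
    (C * R * (innerMatrix Q R T)ᵀ) i j = factorWeight C R T i j / innerMarginal Q j := by
  have h : C * R * (innerMatrix Q R T)ᵀ =
      factorWeight C R T * Matrix.diagonal (fun j => 1 / innerMarginal Q j) := by
    simp only [innerMatrix, factorWeight, Matrix.transpose_mul, Matrix.diagonal_transpose,
      Matrix.mul_assoc]
  rw [h, Matrix.mul_diagonal, mul_one_div]

/-- The weight does not involve `Q`, so each summand is a quotient of two linear forms in one column
of `Q`. -/
lemma objective_eq_sum (C : Matrix (Fin n) (Fin m) ℝ) (Q : Matrix (Fin n) (Fin r) ℝ)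
    (R : Matrix (Fin m) (Fin r) ℝ) (T : Matrix (Fin r) (Fin r) ℝ) :
    objective C Q R T = ∑ j, (∑ i, Q i j * factorWeight C R T i j) / innerMarginal Q j := by
  have h1 : objective C Q R T = Matrix.trace (Q * innerMatrix Q R T * Rᵀ * Cᵀ) := by
    rfl
  have h2 : Q * innerMatrix Q R T * Rᵀ * Cᵀ = Q * (C * R * (innerMatrix Q R T)ᵀ)ᵀ := by
    simp only [Matrix.transpose_mul, Matrix.transpose_transpose, Matrix.mul_assoc]
  rw [h1, h2]
  have hA := mul_innerMatrix_transpose_apply C Q R T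
  generalize C * R * (innerMatrix Q R T)ᵀ = A at hA ⊢
  simp only [Matrix.trace, Matrix.diag_apply, Matrix.mul_apply, Matrix.transpose_apply, hA]
  rw [Finset.sum_comm]
  refine Finset.sum_congr rfl fun j _ => ?_
  rw [Finset.sum_div]
  exact Finset.sum_congr rfl fun i _ => (mul_div_assoc _ _ _).symm

lemma gradQ_apply (C : Matrix (Fin n) (Fin m) ℝ) (x : Triple n m r) (i : Fin n) (j : Fin r) :
    gradQ C x i j = factorWeight C x.R x.T i j / innerMarginal x.Q j -
      (∑ k, x.Q k j * factorWeight C x.R x.T k j) / innerMarginal x.Q j ^ 2 := by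
  have hA := mul_innerMatrix_transpose_apply C x.Q x.R x.T
  rw [gradQ]
  generalize C * x.R * (innerMatrix x.Q x.R x.T)ᵀ = A at hA ⊢
  rw [Matrix.sub_apply, Matrix.vecMulVec_apply, Matrix.diag_apply, Matrix.mul_diagonal,
    Matrix.mul_apply]
  simp only [Matrix.transpose_apply, Pi.one_apply, one_mul, hA]
  rw [Finset.sum_div, Finset.sum_mul]
  congr 1
  exact Finset.sum_congr rfl fun k _ => by ring

lemma gradR_eq_gradQ (C : Matrix (Fin n) (Fin m) ℝ) (x : Triple n m r) :
    gradR C x = gradQ Cᵀ ⟨x.R, x.Q, x.Tᵀ⟩ := by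
  have h : (innerMatrix x.R x.Q x.Tᵀ)ᵀ = innerMatrix x.Q x.R x.T := by
    simp only [innerMatrix, Matrix.transpose_mul, Matrix.diagonal_transpose,
      Matrix.transpose_transpose, Matrix.mul_assoc]
  rw [gradR, gradQ]
  simp only [h]
  congr 2
  rw [← Matrix.diag_transpose]
  simp only [Matrix.transpose_mul, Matrix.diagonal_transpose, Matrix.transpose_transpose,
    Matrix.mul_assoc]

lemma objective_transpose (C : Matrix (Fin n) (Fin m) ℝ) (Q : Matrix (Fin n) (Fin r) ℝ)
    (R : Matrix (Fin m) (Fin r) ℝ) (T : Matrix (Fin r) (Fin r) ℝ) :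
    objective Cᵀ R Q Tᵀ = objective C Q R T := by
  have h : R * innerMatrix R Q Tᵀ * Qᵀ = (Q * innerMatrix Q R T * Rᵀ)ᵀ := by
    simp only [innerMatrix, Matrix.transpose_mul, Matrix.diagonal_transpose,
      Matrix.transpose_transpose, Matrix.mul_assoc]
  rw [objective, objective, h]
  exact Finset.sum_comm

lemma transpose_mem_latentDomain {T : Matrix (Fin r) (Fin r) ℝ} (hT : T ∈ latentDomain r) :
    Tᵀ ∈ latentDomain r :=
  ⟨fun i j => hT.1 j i, Finset.sum_comm.trans_le hT.2⟩

/-- The columns of `C R diag(1/g_R)` are weighted averages of columns of `C`, so no factor `1 / δ`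
appears; the `2` is the mass bound on `T`. -/
lemma abs_factorWeight_le {δ : ℝ} (hδ : 0 < δ) (C : Matrix (Fin n) (Fin m) ℝ)
    {R : Matrix (Fin m) (Fin r) ℝ} (hR : R ∈ factorDomain m r δ)
    {T : Matrix (Fin r) (Fin r) ℝ} (hT : T ∈ latentDomain r) (i : Fin n) (j : Fin r) :
    |factorWeight C R T i j| ≤ 2 * ‖C‖ := by
  have hg : ∀ k, 0 < innerMarginal R k := fun k => hδ.trans (hR.2.2 k)
  have h1 : ∀ k, |(C * R) i k| ≤ ‖C‖ * innerMarginal R k := by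
    intro k
    rw [Matrix.mul_apply, innerMarginal_apply, Finset.mul_sum]
    refine (Finset.abs_sum_le_sum_abs _ _).trans (Finset.sum_le_sum fun l _ => ?_)
    rw [abs_mul, abs_of_nonneg (hR.1 l k)]
    exact mul_le_mul_of_nonneg_right (abs_apply_le_norm C i l) (hR.1 l k)
  rw [factorWeight, Matrix.mul_apply]
  calc |∑ k, (C * R * Matrix.diagonal fun j => 1 / innerMarginal R j) i k * Tᵀ k j|
      ≤ ∑ k, ‖C‖ * T j k := by
        refine (Finset.abs_sum_le_sum_abs _ _).trans (Finset.sum_le_sum fun k _ => ?_)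
        rw [Matrix.mul_diagonal, Matrix.transpose_apply, abs_mul, abs_of_nonneg (hT.1 j k),
          abs_mul, abs_of_pos (one_div_pos.2 (hg k)), mul_one_div]
        refine mul_le_mul_of_nonneg_right ?_ (hT.1 j k)
        exact (div_le_iff₀ (hg k)).2 (h1 k)
    _ = ‖C‖ * ∑ k, T j k := by rw [Finset.mul_sum]
    _ ≤ ‖C‖ * 2 := by
        gcongr
        exact (Finset.single_le_sum (f := fun j => ∑ k, T j k)
          (fun j _ => Finset.sum_nonneg fun k _ => hT.1 j k) (Finset.mem_univ j)).trans hT.2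
    _ = 2 * ‖C‖ := mul_comm _ _

lemma abs_weightedSum_le {Q W : Matrix (Fin n) (Fin r) ℝ} {w : ℝ} (hQ : ∀ i j, 0 ≤ Q i j)
    (hW : ∀ i j, |W i j| ≤ w) (j : Fin r) :
    |∑ i, Q i j * W i j| ≤ w * innerMarginal Q j := by
  rw [innerMarginal_apply, Finset.mul_sum]
  refine (Finset.abs_sum_le_sum_abs _ _).trans (Finset.sum_le_sum fun i _ => ?_)
  rw [abs_mul, abs_of_nonneg (hQ i j), mul_comm]
  exact mul_le_mul_of_nonneg_right (hW i j) (hQ i j)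

lemma abs_gradQ_le {δ : ℝ} (hδ : 0 < δ) (C : Matrix (Fin n) (Fin m) ℝ) {x : Triple n m r}
    (hQ : x.Q ∈ factorDomain n r δ) (hR : x.R ∈ factorDomain m r δ) (hT : x.T ∈ latentDomain r)
    (i : Fin n) (j : Fin r) : |gradQ C x i j| ≤ 4 * ‖C‖ / δ := by
  have hW := abs_factorWeight_le hδ C hR hT
  have hS := abs_weightedSum_le hQ.1 hW j
  have hg := hQ.2.2 j
  have hg0 := hδ.trans hg
  rw [gradQ_apply]
  set g := innerMarginal x.Q j
  have hC : 0 ≤ 2 * ‖C‖ := by positivity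
  have hle : 2 * ‖C‖ / g ≤ 2 * ‖C‖ / δ := by gcongr
  calc _ ≤ _ := abs_sub _ _
    _ ≤ 2 * ‖C‖ / g + 2 * ‖C‖ / g := by
        rw [abs_div, abs_div, abs_of_pos hg0, abs_of_pos (pow_pos hg0 2)]
        refine add_le_add (div_le_div_of_nonneg_right (hW i j) hg0.le) ?_
        rw [div_le_div_iff₀ (pow_pos hg0 2) hg0]
        nlinarith
    _ ≤ 2 * ‖C‖ / δ + 2 * ‖C‖ / δ := by gcongr
    _ = 4 * ‖C‖ / δ := by ring

lemma abs_gradR_le {δ : ℝ} (hδ : 0 < δ) (C : Matrix (Fin n) (Fin m) ℝ) {x : Triple n m r}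
    (hQ : x.Q ∈ factorDomain n r δ) (hR : x.R ∈ factorDomain m r δ) (hT : x.T ∈ latentDomain r)
    (i : Fin m) (j : Fin r) : |gradR C x i j| ≤ 4 * ‖C‖ / δ := by
  rw [gradR_eq_gradQ, ← Matrix.frobenius_norm_transpose C]
  exact abs_gradQ_le hδ Cᵀ (x := ⟨x.R, x.Q, x.Tᵀ⟩) hR hQ (transpose_mem_latentDomain hT) i j

/-! ### Block-wise smoothness -/

/-- The `(i, j)` entry of a matrix as a continuous linear functional. -/
noncomputable def entryCLM (i : Fin n) (j : Fin r) : Matrix (Fin n) (Fin r) ℝ →L[ℝ] ℝ :=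
  LinearMap.toContinuousLinearMap (Matrix.entryLinearMap ℝ ℝ i j)

lemma entryCLM_apply (i : Fin n) (j : Fin r) (M : Matrix (Fin n) (Fin r) ℝ) :
    entryCLM i j M = M i j := rfl

/-- The functional `M ↦ ∑ i, M i j * W i j`. -/
noncomputable def weightedSumCLM (W : Matrix (Fin n) (Fin r) ℝ) (j : Fin r) :
    Matrix (Fin n) (Fin r) ℝ →L[ℝ] ℝ :=
  ∑ i, W i j • entryCLM i j

lemma weightedSumCLM_apply (W : Matrix (Fin n) (Fin r) ℝ) (j : Fin r)
    (M : Matrix (Fin n) (Fin r) ℝ) : weightedSumCLM W j M = ∑ i, M i j * W i j := by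
  simp only [weightedSumCLM, sum_apply, smul_apply,
    entryCLM_apply, smul_eq_mul, mul_comm]

lemma weightedSumCLM_single (W : Matrix (Fin n) (Fin r) ℝ) (i : Fin n) (j k : Fin r) :
    weightedSumCLM W k (Matrix.single i j 1) = if j = k then W i j else 0 := by
  rw [weightedSumCLM_apply]
  by_cases h : j = k
  · subst h
    simp [Matrix.single_apply]
  · simp [h]

/-- The function `M ↦ ∑ j, (∑ i, M i j * W i j) / (∑ i, M i j)`. -/
noncomputable def ratioSum (W M : Matrix (Fin n) (Fin r) ℝ) : ℝ :=
  ∑ j, (∑ i, M i j * W i j) / innerMarginal M j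

lemma hasFDerivAt_ratioSum (W : Matrix (Fin n) (Fin r) ℝ) {M : Matrix (Fin n) (Fin r) ℝ}
    (hM : ∀ j, innerMarginal M j ≠ 0) :
    HasFDerivAt (ratioSum W) (∑ j, ((∑ i, M i j * W i j) •
        (-(innerMarginal M j ^ 2)⁻¹ • weightedSumCLM (Matrix.of fun _ _ => 1) j) +
      (innerMarginal M j)⁻¹ • weightedSumCLM W j)) M := by
  unfold ratioSum
  refine HasFDerivAt.fun_sum fun j _ => ?_
  have hS : HasFDerivAt (fun M : Matrix (Fin n) (Fin r) ℝ => ∑ i, M i j * W i j)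
      (weightedSumCLM W j) M :=
    (weightedSumCLM W j).hasFDerivAt.congr_of_eventuallyEq
      (Filter.Eventually.of_forall fun M => (weightedSumCLM_apply W j M).symm)
  have hg : HasFDerivAt (fun M : Matrix (Fin n) (Fin r) ℝ => innerMarginal M j)
      (weightedSumCLM (Matrix.of fun _ _ => 1) j) M :=
    (weightedSumCLM (Matrix.of fun _ _ => 1) j).hasFDerivAt.congr_of_eventuallyEq
      (Filter.Eventually.of_forall fun M => by
        simp [weightedSumCLM_apply, innerMarginal_apply])
  have hi := (hasDerivAt_inv (hM j)).comp_hasFDerivAt M hg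
  simp only [div_eq_mul_inv]
  exact hS.mul hi

lemma matGradient_ratioSum (W : Matrix (Fin n) (Fin r) ℝ) {M : Matrix (Fin n) (Fin r) ℝ}
    (hM : ∀ j, innerMarginal M j ≠ 0) (i : Fin n) (j : Fin r) :
    matGradient (ratioSum W) M i j =
      W i j / innerMarginal M j - (∑ k, M k j * W k j) / innerMarginal M j ^ 2 := by
  rw [matGradient, Matrix.of_apply, (hasFDerivAt_ratioSum W hM).fderiv]
  simp only [sum_apply, add_apply,
    smul_apply, weightedSumCLM_single, smul_eq_mul, mul_ite, mul_zero,
    Matrix.of_apply, mul_one]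
  simp only [Finset.sum_add_distrib, Finset.sum_ite_eq, Finset.mem_univ, if_true]
  ring

/-- The difference is a sum of four terms, each at most `w * e / δ ^ 2`. Bounding the average `S' /
g'` by `w` avoids a further power of `1 / δ`. -/
lemma abs_sub_ratio_le {S S' g g' W w e δ : ℝ} (hδ : 0 < δ) (hg : δ ≤ g) (hg' : δ ≤ g')
    (hW : |W| ≤ w) (hS : |S' - S| ≤ w * e) (hS' : |S'| ≤ w * g') (hgg : |g' - g| ≤ e) :
    |(W / g' - S' / g' ^ 2) - (W / g - S / g ^ 2)| ≤ 4 * w * e / δ ^ 2 := by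
  have h0 : 0 < g := hδ.trans_le hg
  have h0' : 0 < g' := hδ.trans_le hg'
  have hw : 0 ≤ w := (abs_nonneg _).trans hW
  have he : 0 ≤ e := (abs_nonneg _).trans hgg
  have e1 : (W / g' - S' / g' ^ 2) - (W / g - S / g ^ 2) =
      -(W * (g' - g) / (g * g')) - (S' - S) / g ^ 2 +
        S' / g' * ((g' - g) / g ^ 2) + S' / g' * ((g' - g) / (g * g')) := by
    field_simp
    ring
  have hgg2 : δ ^ 2 ≤ g * g' := by nlinarith
  have hg2 : δ ^ 2 ≤ g ^ 2 := by nlinarith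
  have hR : |S' / g'| ≤ w := by
    rw [abs_div, abs_of_pos h0']
    exact (div_le_iff₀ h0').2 hS'
  have b1 : |(g' - g) / (g * g')| ≤ e / δ ^ 2 := by
    rw [abs_div, abs_of_pos (mul_pos h0 h0')]
    gcongr
  have b2 : |(g' - g) / g ^ 2| ≤ e / δ ^ 2 := by
    rw [abs_div, abs_of_pos (pow_pos h0 2)]
    gcongr
  have b3 : |(S' - S) / g ^ 2| ≤ w * e / δ ^ 2 := by
    rw [abs_div, abs_of_pos (pow_pos h0 2)]
    gcongr
  have c1 : |W * (g' - g) / (g * g')| ≤ w * (e / δ ^ 2) := by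
    rw [mul_div_assoc, abs_mul]
    exact mul_le_mul hW b1 (abs_nonneg _) hw
  have c2 : |S' / g' * ((g' - g) / g ^ 2)| ≤ w * (e / δ ^ 2) := by
    rw [abs_mul]
    exact mul_le_mul hR b2 (abs_nonneg _) hw
  have c3 : |S' / g' * ((g' - g) / (g * g'))| ≤ w * (e / δ ^ 2) := by
    rw [abs_mul]
    exact mul_le_mul hR b1 (abs_nonneg _) hw
  have e2 : 4 * w * e / δ ^ 2 = 4 * (w * (e / δ ^ 2)) := by ring
  rw [mul_div_assoc] at b3
  rw [e1, e2]
  rw [abs_le] at *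
  constructor <;> linarith

lemma smoothOn_ratioSum {W : Matrix (Fin n) (Fin r) ℝ} {w δ β : ℝ} (hδ : 0 < δ)
    (hW : ∀ i j, |W i j| ≤ w) (hw : 0 ≤ w) (hβ : 4 * w / δ ^ 2 * (n ^ 2 * r) ≤ β) :
    SmoothOn (ratioSum W) (factorDomain n r δ) β := by
  have hne : ∀ M ∈ factorDomain n r δ, ∀ j, innerMarginal M j ≠ 0 := fun M hM j =>
    (hδ.trans (hM.2.2 j)).ne'
  refine ⟨fun M hM => (hasFDerivAt_ratioSum W (hne M hM)).differentiableAt,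
    fun M hM M' hM' => ?_⟩
  have hcol : ∀ j, ∑ i, |M' i j - M i j| ≤ n * ‖M' - M‖ := by
    intro j
    calc ∑ i, |M' i j - M i j| ≤ ∑ _i : Fin n, ‖M' - M‖ :=
          Finset.sum_le_sum fun i _ => abs_apply_le_norm (M' - M) i j
      _ = n * ‖M' - M‖ := by simp
  have hentry : ∀ i j, |(matGradient (ratioSum W) M' - matGradient (ratioSum W) M) i j| ≤
      4 * w * (n * ‖M' - M‖) / δ ^ 2 := by
    intro i j
    rw [Matrix.sub_apply, matGradient_ratioSum W (hne M' hM'), matGradient_ratioSum W (hne M hM)]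
    refine abs_sub_ratio_le hδ (hM.2.2 j).le (hM'.2.2 j).le (hW i j) ?_
      (abs_weightedSum_le hM'.1 hW j) ?_
    · refine le_trans ?_ (mul_le_mul_of_nonneg_left (hcol j) hw)
      rw [← Finset.sum_sub_distrib, Finset.mul_sum]
      refine (Finset.abs_sum_le_sum_abs _ _).trans (Finset.sum_le_sum fun k _ => ?_)
      rw [← sub_mul, abs_mul, mul_comm]
      exact mul_le_mul_of_nonneg_right (hW k j) (abs_nonneg _)
    · rw [innerMarginal_apply, innerMarginal_apply, ← Finset.sum_sub_distrib]
      exact (Finset.abs_sum_le_sum_abs _ _).trans (hcol j)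
  calc ‖matGradient (ratioSum W) M' - matGradient (ratioSum W) M‖
      ≤ ∑ i, ∑ j, |(matGradient (ratioSum W) M' - matGradient (ratioSum W) M) i j| :=
        norm_le_sum_abs _
    _ ≤ ∑ _i : Fin n, ∑ _j : Fin r, 4 * w * (n * ‖M' - M‖) / δ ^ 2 :=
        Finset.sum_le_sum fun i _ => Finset.sum_le_sum fun j _ => hentry i j
    _ = 4 * w / δ ^ 2 * (n ^ 2 * r) * ‖M' - M‖ := by
        simp only [Finset.sum_const, Finset.card_univ, Fintype.card_fin, nsmul_eq_mul]
        ring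
    _ ≤ β * ‖M' - M‖ := by gcongr

lemma smoothOn_of_linear {f : Matrix (Fin n) (Fin r) ℝ → ℝ} {S : Set (Matrix (Fin n) (Fin r) ℝ)}
    {β : ℝ} (hf : IsLinearMap ℝ f) (hβ : 0 ≤ β) : SmoothOn f S β := by
  have h : f = LinearMap.toContinuousLinearMap (hf.mk' f) := rfl
  refine ⟨fun M _ => h ▸ ContinuousLinearMap.differentiableAt _, fun M _ M' _ => ?_⟩
  have e : matGradient f M' = matGradient f M := by
    rw [matGradient, matGradient, h]
    simp only [ContinuousLinearMap.fderiv]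
  rw [e, sub_self, norm_zero]
  positivity

lemma isLinearMap_objective (C : Matrix (Fin n) (Fin m) ℝ) (Q : Matrix (Fin n) (Fin r) ℝ)
    (R : Matrix (Fin m) (Fin r) ℝ) : IsLinearMap ℝ fun T => objective C Q R T where
  map_add T T' := by
    simp only [objective, innerMatrix, Matrix.mul_add, Matrix.add_mul, Matrix.add_apply, add_mul,
      Finset.sum_add_distrib]
  map_smul c T := by
    simp only [objective, innerMatrix, Matrix.mul_smul, Matrix.smul_mul, Matrix.smul_apply,
      smul_eq_mul, mul_assoc, Finset.mul_sum]

lemma smoothOn_objective_left (C : Matrix (Fin n) (Fin m) ℝ) {R : Matrix (Fin m) (Fin r) ℝ}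
    {T : Matrix (Fin r) (Fin r) ℝ} {δ β : ℝ} (hδ : 0 < δ) (hR : R ∈ factorDomain m r δ)
    (hT : T ∈ latentDomain r) (hβ : 8 * ‖C‖ * n ^ 2 * r * (1 / δ) ^ 2 ≤ β) :
    SmoothOn (fun Q => objective C Q R T) (factorDomain n r δ) β := by
  have e : (fun Q => objective C Q R T) = ratioSum (factorWeight C R T) :=
    funext fun Q => objective_eq_sum C Q R T
  rw [e]
  refine smoothOn_ratioSum hδ (abs_factorWeight_le hδ C hR hT) (by positivity) (le_trans ?_ hβ)
  apply le_of_eq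
  field_simp
  ring

lemma smoothOn_objective_right (C : Matrix (Fin n) (Fin m) ℝ) {Q : Matrix (Fin n) (Fin r) ℝ}
    {T : Matrix (Fin r) (Fin r) ℝ} {δ β : ℝ} (hδ : 0 < δ) (hQ : Q ∈ factorDomain n r δ)
    (hT : T ∈ latentDomain r) (hβ : 8 * ‖C‖ * m ^ 2 * r * (1 / δ) ^ 2 ≤ β) :
    SmoothOn (fun R => objective C Q R T) (factorDomain m r δ) β := by
  have e : (fun R => objective C Q R T) = fun R => objective Cᵀ R Q Tᵀ :=
    funext fun R => (objective_transpose C Q R T).symm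
  rw [e]
  rw [← Matrix.frobenius_norm_transpose C] at hβ
  exact smoothOn_objective_left Cᵀ hδ hQ (transpose_mem_latentDomain hT) hβ

/-! ### The outer iteration -/

lemma marginal_gt {r N k : ℕ} {δ : ℝ} {g : ℕ → Fin r → ℝ} (hδ : δ < 1 / (r : ℝ))
    (h0 : ∀ i, g 0 i = 1 / (r : ℝ)) (hkN : k ≤ N)
    (h : ∀ k' < k, ‖WithLp.toLp 2 (g (k' + 1) - g k')‖ < 1 / (N : ℝ) * (1 / (r : ℝ) - δ))
    (i : Fin r) : δ < g k i := by
  set c := 1 / (N : ℝ) * (1 / (r : ℝ) - δ) with hc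
  have hstep : ∀ k' < k, g k' i - c < g (k' + 1) i := by
    intro k' hk'
    have h1 := (PiLp.norm_apply_le (WithLp.toLp 2 (g (k' + 1) - g k')) i).trans_lt (h k' hk')
    rw [PiLp.toLp_apply, Pi.sub_apply, Real.norm_eq_abs] at h1
    linarith [(abs_lt.1 h1).1]
  have hge : ∀ k' ≤ k, 1 / (r : ℝ) - k' * c ≤ g k' i := by
    intro k' hk'
    induction k' with
    | zero => simp [h0 i]
    | succ k' ih =>
      push_cast
      linarith [ih (by omega), hstep k' (by omega)]
  -- Strictness comes from the last step, so `k = 0` is separate; it is also the only case when `N =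
  -- 0`.
  rcases Nat.eq_zero_or_pos k with rfl | hk
  · rw [h0 i]; exact hδ
  obtain ⟨k', rfl⟩ := Nat.exists_eq_add_of_le' hk
  have hN : (0 : ℝ) < N := by exact_mod_cast (by omega : 0 < N)
  have hc0 : 0 ≤ c := mul_nonneg (by positivity) (by linarith)
  have hNc : (N : ℝ) * c = 1 / (r : ℝ) - δ := by rw [hc]; field_simp
  have hkc : ((k' : ℝ) + 1) * c ≤ N * c := by
    gcongr
    exact_mod_cast hkN
  linarith [hge k' (by omega), hstep k' (by omega)]

/-- Nonnegative triples whose outer marginals are close to `a` and `b`. -/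
structure AlmostFeasible (η : ℝ) (a : Fin n → ℝ) (b : Fin m → ℝ) (x : Triple n m r) : Prop where
  Q_nonneg : ∀ i j, 0 ≤ x.Q i j
  R_nonneg : ∀ i j, 0 ≤ x.R i j
  Q_close : LogClose η (x.Q *ᵥ 1) a
  R_close : LogClose η (x.R *ᵥ 1) b
  T_mem : x.T ∈ latentDomain r

lemma mem_factorDomain {Q : Matrix (Fin n) (Fin r) ℝ} {a : Fin n → ℝ} {η δ : ℝ}
    (hη : η ≤ 1 / 2) (ha : a ∈ stdSimplex ℝ (Fin n)) (hQ : ∀ i j, 0 ≤ Q i j)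
    (hc : LogClose η (Q *ᵥ 1) a) (hg : ∀ j, δ < innerMarginal Q j) : Q ∈ factorDomain n r δ := by
  refine ⟨hQ, ?_, hg⟩
  have h := ProjectionData.sum_innerMarginal_le hc ha.2 hη
  simp only [innerMarginal_apply] at h
  exact Finset.sum_comm.trans_le h

lemma norm_toLp_lt {g : Fin r → ℝ} {ε : ℝ} (hε : 0 < ε) (h : ∑ j, g j ^ 2 < ε ^ 2) :
    ‖WithLp.toLp 2 g‖ < ε := by
  refine lt_of_pow_lt_pow_left₀ 2 hε.le ?_
  rw [EuclideanSpace.norm_sq_eq]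
  simpa using h

/-- The tolerance `η` is the same before and after the step, so the induction loses nothing in the
row sums. -/
lemma almostFeasible_step (C : Matrix (Fin n) (Fin m) ℝ) {δ ε η τ γ γT : ℝ} {lQ lR lT L : ℕ}
    {a : Fin n → ℝ} {b : Fin m → ℝ} {x : Triple n m r} (hδ : 0 < δ) (hε : 0 < ε)
    (hη : η ≤ 1 / 2) (ha : a ∈ stdSimplex ℝ (Fin n)) (hb : b ∈ stdSimplex ℝ (Fin m))
    (hx : AlmostFeasible η a b x) (hgQ : ∀ j, δ < innerMarginal x.Q j)
    (hgR : ∀ j, δ < innerMarginal x.R j)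
    (hbound : 4 * (1 + 4 * (4 * ‖C‖ / δ)) / τ + 32 * η < ε ^ 2)
    (hLQ : ∀ (Q G : Matrix (Fin n) (Fin r) ℝ) (a : Fin n → ℝ),
      ProjectionData Q G a (4 * ‖C‖ / δ) η → ∀ l ≥ L, ∀ P,
        P = srProjection (mdKernel Q G γ) γ τ a (innerMarginal Q) l →
        (∀ i j, 0 ≤ P i j) ∧ LogClose η (P *ᵥ 1) a ∧
        ∑ j, (innerMarginal P j - innerMarginal Q j) ^ 2 ≤
          4 * (1 + 4 * (4 * ‖C‖ / δ)) / τ + 32 * η)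
    (hLR : ∀ (Q G : Matrix (Fin m) (Fin r) ℝ) (a : Fin m → ℝ),
      ProjectionData Q G a (4 * ‖C‖ / δ) η → ∀ l ≥ L, ∀ P,
        P = srProjection (mdKernel Q G γ) γ τ a (innerMarginal Q) l →
        (∀ i j, 0 ≤ P i j) ∧ LogClose η (P *ᵥ 1) a ∧
        ∑ j, (innerMarginal P j - innerMarginal Q j) ^ 2 ≤
          4 * (1 + 4 * (4 * ‖C‖ / δ)) / τ + 32 * η)
    (hlQ : L ≤ lQ) (hlR : L ≤ lR) (hlT : 1 ≤ lT) :
    AlmostFeasible η a b (step C a b τ γ γT lQ lR lT x) ∧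
    ‖WithLp.toLp 2 (innerMarginal (step C a b τ γ γT lQ lR lT x).Q - innerMarginal x.Q)‖ < ε ∧
    ‖WithLp.toLp 2 (innerMarginal (step C a b τ γ γT lQ lR lT x).R - innerMarginal x.R)‖ < ε := by
  have hQ := mem_factorDomain hη ha hx.Q_nonneg hx.Q_close hgQ
  have hR := mem_factorDomain hη hb hx.R_nonneg hx.R_close hgR
  have dQ : ProjectionData x.Q (gradQ C x) a (4 * ‖C‖ / δ) η :=
    ⟨hx.Q_nonneg, ha.1, ha.2, abs_gradQ_le hδ C hQ hR hx.T_mem, hx.Q_close,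
      fun j => hδ.trans (hgQ j)⟩
  have dR : ProjectionData x.R (gradR C x) b (4 * ‖C‖ / δ) η :=
    ⟨hx.R_nonneg, hb.1, hb.2, abs_gradR_le hδ C hQ hR hx.T_mem, hx.R_close,
      fun j => hδ.trans (hgR j)⟩
  obtain ⟨q1, q2, q3⟩ := hLQ _ _ _ dQ lQ hlQ (step C a b τ γ γT lQ lR lT x).Q rfl
  obtain ⟨r1, r2, r3⟩ := hLR _ _ _ dR lR hlR (step C a b τ γ γT lQ lR lT x).R rfl
  refine ⟨⟨q1, r1, q2, r2, ?_⟩, norm_toLp_lt hε (q3.trans_lt hbound),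
    norm_toLp_lt hε (r3.trans_lt hbound)⟩
  refine sinkhorn_mem_latentDomain (fun i j => mul_nonneg (hx.T_mem.1 i j) (Real.exp_pos _).le)
    (fun j => ?_) (fun j => ?_) (ProjectionData.sum_innerMarginal_le r2 hb.2 hη) hlT
  · exact (Finset.sum_nonneg fun i _ => q1 i j).trans_eq (innerMarginal_apply _ j).symm
  · exact (Finset.sum_nonneg fun i _ => r1 i j).trans_eq (innerMarginal_apply _ j).symm

lemma almostFeasible_of_couplings {η : ℝ} {a : Fin n → ℝ} {b : Fin m → ℝ} {x : Triple n m r}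
    (hr : 0 < r) (hη : 0 ≤ η) (ha : a ∈ stdSimplex ℝ (Fin n)) (hb : b ∈ stdSimplex ℝ (Fin m))
    (hQ : x.Q ∈ couplings a (fun _ => 1 / (r : ℝ)))
    (hR : x.R ∈ couplings b (fun _ => 1 / (r : ℝ)))
    (hT : x.T ∈ couplings (fun _ => 1 / (r : ℝ)) (fun _ => 1 / (r : ℝ))) :
    AlmostFeasible η a b x := by
  refine ⟨hQ.1, hR.1, ?_, ?_, hT.1, ?_⟩
  · rw [hQ.2.1]; exact LogClose.refl hη ha.1
  · rw [hR.2.1]; exact LogClose.refl hη hb.1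
  · simp only [← mulVec_one_apply, hT.2.1]
    have : (r : ℝ) ≠ 0 := by exact_mod_cast hr.ne'
    simp [this]

end FRLC

theorem mainTheorem3 :
    -- small changes of a marginal over `N` iterations keep it above `δ`
    (∀ (r N : ℕ) (δ : ℝ) (g : ℕ → Fin r → ℝ), 0 < r → 0 < δ → δ < 1 / (r : ℝ) →
      (∀ i, g 0 i = 1 / (r : ℝ)) →
      (∀ k < N, ‖WithLp.toLp 2 (g (k + 1) - g k)‖ < 1 / (N : ℝ) * (1 / (r : ℝ) - δ)) →
      ∀ k ≤ N, ∀ i, δ < g k i) ∧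
    -- for large `τ` and enough inner iterations the algorithm has this property
    (∀ (n m r N : ℕ) (C : Matrix (Fin n) (Fin m) ℝ) (δ : ℝ), 0 < r → 0 < δ → δ < 1 / (r : ℝ) →
      ∃ τ₀ : ℝ, 0 < τ₀ ∧ ∀ τ : ℝ, τ₀ ≤ τ → ∃ l₀ : ℝ → ℕ,
        ∀ (a : Fin n → ℝ) (b : Fin m → ℝ) (x₀ : FRLC.Triple n m r)
          (γ γT : ℕ → ℝ) (lQ lR lT : ℕ → ℕ),
          a ∈ stdSimplex ℝ (Fin n) → b ∈ stdSimplex ℝ (Fin m) →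
          x₀.Q ∈ FRLC.couplings a (fun _ => 1 / (r : ℝ)) →
          x₀.R ∈ FRLC.couplings b (fun _ => 1 / (r : ℝ)) →
          x₀.T ∈ FRLC.couplings (fun _ => 1 / (r : ℝ)) (fun _ => 1 / (r : ℝ)) →
          (∀ k, 0 < γ k) → (∀ k, 0 < γT k) →
          (∀ k < N, l₀ (γ k) ≤ lQ k ∧ l₀ (γ k) ≤ lR k ∧ 1 ≤ lT k) →
          let x := FRLC.iterate C a b τ γ γT lQ lR lT x₀
          (∀ k < N,
            ‖WithLp.toLp 2 (FRLC.innerMarginal (x (k + 1)).Q - FRLC.innerMarginal (x k).Q)‖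
                < 1 / (N : ℝ) * (1 / (r : ℝ) - δ) ∧
            ‖WithLp.toLp 2 (FRLC.innerMarginal (x (k + 1)).R - FRLC.innerMarginal (x k).R)‖
                < 1 / (N : ℝ) * (1 / (r : ℝ) - δ)) ∧
          ∀ k ≤ N,
            (∀ i, δ < FRLC.innerMarginal (x k).Q i) ∧
            (∀ i, δ < FRLC.innerMarginal (x k).R i) ∧
            (x k).Q ∈ FRLC.factorDomain n r δ ∧
            (x k).R ∈ FRLC.factorDomain m r δ ∧
            (x k).T ∈ FRLC.latentDomain r) ∧
    -- under the lower bound the objective is smooth in each block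
    (∃ pQ pR pT : MvPolynomial (Fin 5) ℝ,
      ∀ (n m r : ℕ) (C : Matrix (Fin n) (Fin m) ℝ) (δ : ℝ), 0 < r → 0 < δ → δ < 1 / (r : ℝ) →
        let y : Fin 5 → ℝ := ![‖C‖, (n : ℝ), (m : ℝ), (r : ℝ), 1 / δ]
        let βQ := MvPolynomial.eval y pQ
        let βR := MvPolynomial.eval y pR
        let βT := MvPolynomial.eval y pT
        (0 < βQ ∧ 0 < βR ∧ 0 < βT) ∧
        (∀ R ∈ FRLC.factorDomain m r δ, ∀ T ∈ FRLC.latentDomain r,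
          FRLC.SmoothOn (fun Q => FRLC.objective C Q R T) (FRLC.factorDomain n r δ) βQ) ∧
        (∀ Q ∈ FRLC.factorDomain n r δ, ∀ T ∈ FRLC.latentDomain r,
          FRLC.SmoothOn (fun R => FRLC.objective C Q R T) (FRLC.factorDomain m r δ) βR) ∧
        (∀ Q ∈ FRLC.factorDomain n r δ, ∀ R ∈ FRLC.factorDomain m r δ,
          FRLC.SmoothOn (fun T => FRLC.objective C Q R T) (FRLC.latentDomain r) βT)) := by
  refine ⟨fun r N δ g _ _ hδ1 h0 h k hk i =>
    FRLC.marginal_gt hδ1 h0 hk (fun k' hk' => h k' (hk'.trans_le hk)) i, ?_, ?_⟩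
  · intro n m r N C δ hr hδ hδ1
    have hd : 0 < 1 / (r : ℝ) - δ := by linarith
    -- Using `N + 1` keeps `ε` positive when `N = 0`, where `1 / N` is `0`.
    obtain ⟨ε, hε, hεN⟩ : ∃ ε : ℝ, 0 < ε ∧ (0 < N → ε ≤ 1 / (N : ℝ) * (1 / (r : ℝ) - δ)) := by
      refine ⟨1 / ((N : ℝ) + 1) * (1 / (r : ℝ) - δ), by positivity, fun hN => ?_⟩
      have hN' : (0 : ℝ) < N := by exact_mod_cast hN
      gcongr
      linarith
    obtain ⟨η, hη, hη2, hηε⟩ : ∃ η : ℝ, 0 < η ∧ η ≤ 1 / 2 ∧ 64 * η ≤ ε ^ 2 :=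
      ⟨min (1 / 2) (ε ^ 2 / 64), by positivity, min_le_left _ _, by
        linarith [min_le_right (1 / 2) (ε ^ 2 / 64)]⟩
    set M := 4 * ‖C‖ / δ with hMdef
    have hM : 0 ≤ M := by positivity
    -- The penalty term becomes at most `ε ^ 2 / 4` and the `η` term at most `ε ^ 2 / 2`.
    refine ⟨16 * (1 + 4 * M) / ε ^ 2, by positivity, fun τ hτ => ?_⟩
    have hτ0 : 0 < τ := lt_of_lt_of_le (by positivity) hτ
    have hbound : 4 * (1 + 4 * M) / τ + 32 * η < ε ^ 2 := by
      have h1 : 4 * (1 + 4 * M) / τ ≤ ε ^ 2 / 4 := by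
        rw [div_le_iff₀ (by positivity)] at hτ
        rw [div_le_iff₀ hτ0]
        linarith
      have : 0 < ε ^ 2 := by positivity
      linarith
    -- Positivity of `γ` sits inside the existential so that `choose` yields a function on all of
    -- `ℝ`.
    have hex : ∀ γ : ℝ, ∃ L : ℕ, 0 < γ →
        (∀ (Q G : Matrix (Fin n) (Fin r) ℝ) (a : Fin n → ℝ), FRLC.ProjectionData Q G a M η →
          ∀ l ≥ L, ∀ P, P = FRLC.srProjection (FRLC.mdKernel Q G γ) γ τ a
              (FRLC.innerMarginal Q) l →
            (∀ i j, 0 ≤ P i j) ∧ FRLC.LogClose η (P *ᵥ 1) a ∧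
            ∑ j, (FRLC.innerMarginal P j - FRLC.innerMarginal Q j) ^ 2 ≤
              4 * (1 + 4 * M) / τ + 32 * η) ∧
        (∀ (Q G : Matrix (Fin m) (Fin r) ℝ) (a : Fin m → ℝ), FRLC.ProjectionData Q G a M η →
          ∀ l ≥ L, ∀ P, P = FRLC.srProjection (FRLC.mdKernel Q G γ) γ τ a
              (FRLC.innerMarginal Q) l →
            (∀ i j, 0 ≤ P i j) ∧ FRLC.LogClose η (P *ᵥ 1) a ∧
            ∑ j, (FRLC.innerMarginal P j - FRLC.innerMarginal Q j) ^ 2 ≤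
              4 * (1 + 4 * M) / τ + 32 * η) := by
      intro γ
      by_cases hγ : 0 < γ
      · obtain ⟨L, hL⟩ := FRLC.exists_srProjection_bound n r hM hη hη2 hγ hτ0
        obtain ⟨L', hL'⟩ := FRLC.exists_srProjection_bound m r hM hη hη2 hγ hτ0
        exact ⟨max L L', fun _ =>
          ⟨fun Q G a h l hl => hL Q G a h l (le_of_max_le_left hl),
            fun Q G a h l hl => hL' Q G a h l (le_of_max_le_right hl)⟩⟩
      · exact ⟨0, fun h => absurd h hγ⟩
    choose l₀ hl₀ using hex
    refine ⟨l₀, fun a b x₀ γ γT lQ lR lT ha hb hQ hR hT hγ _ hl => ?_⟩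
    intro x
    have hg0Q : ∀ i, FRLC.innerMarginal (x 0).Q i = 1 / (r : ℝ) := fun i => congrFun hQ.2.2 i
    have hg0R : ∀ i, FRLC.innerMarginal (x 0).R i = 1 / (r : ℝ) := fun i => congrFun hR.2.2 i
    have hinv : ∀ k ≤ N, FRLC.AlmostFeasible η a b (x k) ∧ ∀ k' < k,
        ‖WithLp.toLp 2 (FRLC.innerMarginal (x (k' + 1)).Q - FRLC.innerMarginal (x k').Q)‖
          < 1 / (N : ℝ) * (1 / (r : ℝ) - δ) ∧
        ‖WithLp.toLp 2 (FRLC.innerMarginal (x (k' + 1)).R - FRLC.innerMarginal (x k').R)‖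
          < 1 / (N : ℝ) * (1 / (r : ℝ) - δ) := by
      intro k hk
      induction k with
      | zero =>
        exact ⟨FRLC.almostFeasible_of_couplings hr hη.le ha hb hQ hR hT,
          fun k' hk' => absurd hk' (Nat.not_lt_zero _)⟩
      | succ k ih =>
        obtain ⟨hx, hs⟩ := ih (by omega)
        have hgQ := FRLC.marginal_gt (g := fun k => FRLC.innerMarginal (x k).Q) hδ1 hg0Q
          (by omega : k ≤ N) (fun k' hk' => (hs k' hk').1)
        have hgR := FRLC.marginal_gt (g := fun k => FRLC.innerMarginal (x k).R) hδ1 hg0R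
          (by omega : k ≤ N) (fun k' hk' => (hs k' hk').2)
        obtain ⟨h1, h2, h3⟩ := hl k (by omega)
        obtain ⟨hx', hsQ, hsR⟩ := FRLC.almostFeasible_step C (γT := γT k) hδ hε hη2 ha hb hx
          hgQ hgR hbound (hl₀ (γ k) (hγ k)).1 (hl₀ (γ k) (hγ k)).2 h1 h2 h3
        refine ⟨hx', fun k' hk' => ?_⟩
        rcases Nat.lt_succ_iff_lt_or_eq.1 hk' with hlt | rfl
        · exact hs k' hlt
        · have hle := hεN (by omega)
          exact ⟨hsQ.trans_le hle, hsR.trans_le hle⟩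
    refine ⟨(hinv N le_rfl).2, fun k hk => ?_⟩
    obtain ⟨hx, hs⟩ := hinv k hk
    have hgQ := FRLC.marginal_gt (g := fun k => FRLC.innerMarginal (x k).Q) hδ1 hg0Q hk
      (fun k' hk' => (hs k' hk').1)
    have hgR := FRLC.marginal_gt (g := fun k => FRLC.innerMarginal (x k).R) hδ1 hg0R hk
      (fun k' hk' => (hs k' hk').2)
    exact ⟨hgQ, hgR, FRLC.mem_factorDomain hη2 ha hx.Q_nonneg hx.Q_close hgQ,
      FRLC.mem_factorDomain hη2 hb hx.R_nonneg hx.R_close hgR, hx.T_mem⟩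
  -- The added `1` makes the constants positive even if `C = 0`; for `T` the gradient is constant,
  -- so any positive constant works.
  · refine ⟨MvPolynomial.C 8 * MvPolynomial.X 0 * MvPolynomial.X 1 ^ 2 * MvPolynomial.X 3 *
        MvPolynomial.X 4 ^ 2 + 1,
      MvPolynomial.C 8 * MvPolynomial.X 0 * MvPolynomial.X 2 ^ 2 * MvPolynomial.X 3 *
        MvPolynomial.X 4 ^ 2 + 1, 1, ?_⟩
    intro n m r C δ hr hδ hδ1 y βQ βR βT
    have eQ : βQ = 8 * ‖C‖ * n ^ 2 * r * (1 / δ) ^ 2 + 1 := by simp [βQ, y]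
    have eR : βR = 8 * ‖C‖ * m ^ 2 * r * (1 / δ) ^ 2 + 1 := by simp [βR, y]
    have eT : βT = 1 := by simp [βT]
    refine ⟨⟨by rw [eQ]; positivity, by rw [eR]; positivity, by rw [eT]; positivity⟩, ?_, ?_, ?_⟩
    · intro R hR T hT
      exact FRLC.smoothOn_objective_left C hδ hR hT (by rw [eQ]; linarith)
    · intro Q hQ T hT
      exact FRLC.smoothOn_objective_right C hδ hQ hT (by rw [eR]; linarith)
    · intro Q _ R _
      exact FRLC.smoothOn_of_linear (FRLC.isLinearMap_objective C Q R) (by rw [eT]; positivity)
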